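/- Let $\Omega\subset\mathbb{R}^N$ be a non-empty open set and $1<p<\infty$. Let $W^{1,p}(\Omega)$ be the real first order Sobolev space with norm $\|u\|^p=\|u\|_{L^p(\Omega)}^p+\sum_{i=1}^N\|\partial_i u\|_{L^p(\Omega)}^p$, and let $\tilde W^{1,p}(\Omega)$ be the closure in $W^{1,p}(\Omega)$ of $\{f|_\Omega : f\in C_c(\overline\Omega),\ f|_\Omega\in W^{1,p}(\Omega)\}$. For $A\subset\overline\Omega$ the relative $p$-capacity is $$\mathrm{Cap}_{p,\Omega}(A)=\inf\{\|u\|^p : u\in\tilde W^{1,p}(\Omega),\ u\ge 1 \text{ a.e. on } O\cap\Omega \text{ for some } O\supset A \text{ open in } \overline\Omega\}\in[0,\infty].$$ A property holds q.e. on a set $S\subset\overline\Omega$ if the subset of $S$ where it fails has relative $p$-capacity zero. A function $u:\overline\Omega\to\mathbb{R}$ is quasi-continuous if for every $\varepsilon>0$ there is a set $V$, open in $\overline\Omega$, with $\mathrm{Cap}_{p,\Omega}(V)<\varepsilon$ such that $u|_{\overline\Omega\setminus V}$ is continuous. Let $\mathcal{W}^{1,p}(\Omega)$ be the set of all classes $[u]$,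 modulo equality q.e. on $\overline\Omega$, of quasi-continuous functions $u:\overline\Omega\to\mathbb{R}$ that agree a.e. on $\Omega$ with an element of $\tilde W^{1,p}(\Omega)$; the norm of $[u]$ is the $W^{1,p}(\Omega)$-norm of that element. Then for every $A\subset\overline\Omega$ with $\mathrm{Cap}_{p,\Omega}(A)<\infty$ there exists a unique $e_A\in\mathcal{W}^{1,p}(\Omega)$ such that $e_A\ge 1$ q.e. on $A$ and $\|e_A\|^p=\mathrm{Cap}_{p,\Omega}(A)$. Moreover, $0\le e_A\le 1$ q.e. on $\overline\Omega$ and $e_A=1$ q.e. on $A$. -/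

import Mathlib

open MeasureTheory Set
open scoped ENNReal

noncomputable section

namespace RelativeCapacity

/-- The Euclidean space `ℝ^N`. -/
abbrev Eucl (N : ℕ) : Type := EuclideanSpace ℝ (Fin N)

/-- The space `L^p(Ω)^{N+1}`. The coordinate `none` holds a function `u`, and the coordinate
`some i` a candidate for its partial derivative `∂_i u`. For `1 ≤ p < ∞` its norm is given by
`‖U‖ ^ p = ‖U none‖_{L^p(Ω)} ^ p + ∑ i, ‖U (some i)‖_{L^p(Ω)} ^ p`. -/
abbrev LpJet {N : ℕ} (p : ℝ≥0∞) (Ω : Set (Eucl N)) : Type :=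
  PiLp p (fun _ : Option (Fin N) => Lp ℝ p (volume.restrict Ω))

/-- `g` is the `i`-th partial derivative of `u` on `Ω` in the sense of distributions. -/
def IsWeakPartial {N : ℕ} (Ω : Set (Eucl N)) (i : Fin N) (u g : Eucl N → ℝ) : Prop :=
  ∀ φ : Eucl N → ℝ, ContDiff ℝ (⊤ : ℕ∞) φ → HasCompactSupport φ → tsupport φ ⊆ Ω →
    ∫ x in Ω, u x * fderiv ℝ φ x (EuclideanSpace.single i 1) = - ∫ x in Ω, g x * φ x

variable {N : ℕ} (p : ℝ≥0∞) (Ω : Set (Eucl N))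

/-- The Sobolev space `W^{1,p}(Ω)`. An element `u` is recorded together with its weak partial
derivatives, which are determined by `u`; the norm inherited from `LpJet p Ω` is the Sobolev norm
`‖u‖ ^ p = ∑_{|α| ≤ 1} ‖D^α u‖_{L^p(Ω)} ^ p`. -/
def sobolev : Set (LpJet p Ω) :=
  {U | ∀ i : Fin N, IsWeakPartial Ω i (U none) (U (some i))}

/-- `f` restricts to an element of `C_c(closure Ω)`; the values of `f` off `closure Ω` play no
role. -/
def IsCcClosure (f : Eucl N → ℝ) : Prop :=
  ContinuousOn f (closure Ω) ∧ ∃ K, IsCompact K ∧ ∀ x ∈ closure Ω \ K, f x = 0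

/-- `W^{1,p}(Ω) ∩ C_c(closure Ω)`. -/
def sobolevCc : Set (LpJet p Ω) :=
  {U | U ∈ sobolev p Ω ∧ ∃ f, IsCcClosure Ω f ∧ U none =ᵐ[volume.restrict Ω] f}

variable [Fact (1 ≤ p)]

/-- The closure of `W^{1,p}(Ω) ∩ C_c(closure Ω)` in `W^{1,p}(Ω)`. -/
def sobolevTilde : Set (LpJet p Ω) :=
  closure (sobolevCc p Ω) ∩ sobolev p Ω

/-- The admissible functions for `A ⊆ closure Ω`: those that are `≥ 1` a.e. on `O ∩ Ω` for some
`O ⊇ A` open in `closure Ω`. Here `O = V ∩ closure Ω` with `V` open in `ℝ^N`, so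
`O ∩ Ω = V ∩ Ω`. -/
def admissible (A : Set (Eucl N)) : Set (LpJet p Ω) :=
  {U | U ∈ sobolevTilde p Ω ∧ ∃ V, IsOpen V ∧ A ⊆ V ∧
    ∀ᵐ x ∂(volume.restrict (V ∩ Ω)), 1 ≤ U none x}

/-- The relative `p`-capacity of `A ⊆ closure Ω`, with value `∞` if no function is admissible. -/
def relCap (A : Set (Eucl N)) : ℝ≥0∞ :=
  ⨅ U ∈ admissible p Ω A, ‖U‖ₑ ^ p.toReal

/-- The property `P` holds quasi everywhere on `S ⊆ closure Ω`: its exceptional set in `S` has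
relative capacity zero. -/
def QEOn (S : Set (Eucl N)) (P : Eucl N → Prop) : Prop :=
  relCap p Ω {x ∈ S | ¬ P x} = 0

/-- `u` is quasi continuous on `closure Ω`: off sets `V ∩ closure Ω`, open in `closure Ω`, of
arbitrarily small relative capacity its restriction is continuous. Only the values of `u` on
`closure Ω` matter. -/
def IsQuasiCont (u : Eucl N → ℝ) : Prop :=
  ∀ ε : ℝ≥0∞, 0 < ε → ∃ V, IsOpen V ∧ relCap p Ω (V ∩ closure Ω) < ε ∧
    ContinuousOn u (closure Ω \ V)

/-- The equivalence class `[u]` of `u`: all quasi continuous functions that agree with `u` quasi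
everywhere on `closure Ω`. -/
def qeClass (u : Eucl N → ℝ) : Set (Eucl N → ℝ) :=
  {v | IsQuasiCont p Ω v ∧ QEOn p Ω (closure Ω) (fun x => v x = u x)}

/-- `c` is the class of a quasi continuous version of the Sobolev function `U`. -/
def IsRefinement (U : LpJet p Ω) (c : Set (Eucl N → ℝ)) : Prop :=
  ∃ u, IsQuasiCont p Ω u ∧ U none =ᵐ[volume.restrict Ω] u ∧ c = qeClass p Ω u

/-- The class `c` is a capacitary extremal for `A`: it belongs to the refined Sobolev space, that
is, it is the refinement of some `U` in `sobolevTilde p Ω` (whose norm is the norm of `c`), it is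
`≥ 1` quasi everywhere on `A`, and its norm to the power `p` is the relative capacity of `A`. -/
def IsExtremal (A : Set (Eucl N)) (c : Set (Eucl N → ℝ)) : Prop :=
  ∃ U ∈ sobolevTilde p Ω, IsRefinement p Ω U c ∧
    (∀ u ∈ c, QEOn p Ω A (fun x => 1 ≤ u x)) ∧ ‖U‖ₑ ^ p.toReal = relCap p Ω A

end RelativeCapacity

end

/-! The admissible functions for `A` form a convex set that need not be closed, because each must be
at least 1 a.e. near `A`. It is replaced by `candidates`: Sobolev functions with a quasi continuous
version that is at least 1 q.e. on `A`. This set contains the admissible functions, and each of its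
elements still has norm at least Cap^(1/p) (`capRoot_le_enorm_of_qeOn`). It is closed by the
capacitary Chebyshev inequality, and it is stable under midpoints. The Sobolev norm is uniformly
convex for 1 < p < ∞ (`exists_forall_norm_sub_lt`). Hence minimizing sequences are Cauchy and the
minimizer is unique; its quasi continuous versions agree q.e., which gives uniqueness of the class.

The bounds 0 ≤ e ≤ 1 hold because truncation at 0 or at 1 keeps a candidate and does not increase
its norm, so the minimizer equals its truncations. Truncations are reached as limits of C¹
contractions T, with T(u)/T(1) as competitor. This needs only the C¹ chain rule for weak
derivatives, proved by mollification.

The capacity theory is carried by the p-th root `capRoot`. Adding smoothed positive parts and using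
the triangle inequality makes it countably subadditive, so no maximum of Sobolev functions is
needed. Subadditivity yields the Chebyshev inequality, the existence of quasi continuous versions
and the passage from a.e. to q.e. inequalities. -/

noncomputable section

/-! ### Mollification and its convergence in L¹. -/

namespace RelativeCapacity

open Filter Topology
open scoped Convolution

/-- Fatou's lemma with a converging dominating sequence: if `f n → f` a.e., `|f n| ≤ g n`,
`g n → |f|` a.e. and `∫ g n = ∫ |f|`, then `f n → f` in `L¹`. -/
theorem tendsto_integral_abs_sub_of_dominating {α : Type*} [MeasurableSpace α] {μ : Measure α}
    {F G : ℕ → α → ℝ} {f : α → ℝ} (hf : Integrable f μ) (hF : ∀ n, Integrable (F n) μ)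
    (hG : ∀ n, Integrable (G n) μ) (hle : ∀ n, ∀ᵐ x ∂μ, |F n x| ≤ G n x)
    (hFf : ∀ᵐ x ∂μ, Tendsto (fun n => F n x) atTop (𝓝 (f x)))
    (hGf : ∀ᵐ x ∂μ, Tendsto (fun n => G n x) atTop (𝓝 |f x|))
    (hint : ∀ n, ∫ x, G n x ∂μ = ∫ x, |f x| ∂μ) :
    Tendsto (fun n => ∫ x, |F n x - f x| ∂μ) atTop (𝓝 0) := by
  set I := ∫ x, |f x| ∂μ with hI
  -- This is nonnegative since |F n - f| ≤ G n + |f|, and it tends to 2|f| a.e. Fatou then forces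
  -- the subtracted integrals to 0.
  set h : ℕ → α → ℝ := fun n x => G n x + |f x| - |F n x - f x| with hh
  have hhi : ∀ n, Integrable (h n) μ := fun n => ((hG n).add hf.abs).sub ((hF n).sub hf).abs
  have hh0 : ∀ n, 0 ≤ᵐ[μ] h n := fun n => by
    filter_upwards [hle n] with x hx
    have := abs_sub (F n x) (f x)
    simp only [hh, Pi.zero_apply]; linarith
  have hhint : ∀ n, ∫ x, h n x ∂μ = 2 * I - ∫ x, |F n x - f x| ∂μ := fun n => by
    have e1 := integral_sub ((hG n).add hf.abs) ((hF n).sub hf).abs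
    have e2 := integral_add (hG n) hf.abs
    simp only [Pi.add_apply, Pi.sub_apply] at e1 e2
    simp only [hh]
    rw [e1, e2, hint n]; ring
  have hlim : ∀ᵐ x ∂μ, Tendsto (fun n => ENNReal.ofReal (h n x)) atTop
      (𝓝 (ENNReal.ofReal (2 * |f x|))) := by
    filter_upwards [hFf, hGf] with x h1 h2
    refine (ENNReal.continuous_ofReal.tendsto _).comp ?_
    have := (h2.add_const |f x|).sub ((h1.sub_const (f x)).abs)
    simpa [hh, two_mul] using this
  have hfatou : ENNReal.ofReal (2 * I) ≤
      liminf (fun n => ENNReal.ofReal (2 * I - ∫ x, |F n x - f x| ∂μ)) atTop := by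
    calc ENNReal.ofReal (2 * I) = ∫⁻ x, ENNReal.ofReal (2 * |f x|) ∂μ := by
          rw [hI, ← integral_const_mul, ofReal_integral_eq_lintegral_ofReal (hf.abs.const_mul 2)]
          exact Eventually.of_forall fun x => by simp
      _ = ∫⁻ x, liminf (fun n => ENNReal.ofReal (h n x)) atTop ∂μ := by
          refine lintegral_congr_ae ?_
          filter_upwards [hlim] with x hx using hx.liminf_eq.symm
      _ ≤ liminf (fun n => ∫⁻ x, ENNReal.ofReal (h n x) ∂μ) atTop :=
          lintegral_liminf_le' fun n => (hhi n).aestronglyMeasurable.aemeasurable.ennreal_ofReal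
      _ = _ := by
          congr 1; funext n
          rw [← hhint n, ofReal_integral_eq_lintegral_ofReal (hhi n) (hh0 n)]
  have hI0 : 0 ≤ I := integral_nonneg fun x => abs_nonneg _
  have ha0 : ∀ n, 0 ≤ ∫ x, |F n x - f x| ∂μ := fun n => integral_nonneg fun x => abs_nonneg _
  have ha1 : ∀ n, ∫ x, |F n x - f x| ∂μ ≤ 2 * I := fun n => by
    have := integral_nonneg_of_ae (hh0 n)
    rw [hhint n] at this; linarith
  rw [Metric.tendsto_atTop']
  intro ε hε
  have key : ∀ᶠ n in atTop, ∫ x, |F n x - f x| ∂μ < ε := by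
    -- When 2I < ε the trivial bound 2I suffices; otherwise 2I - ε ≥ 0, and `ENNReal.ofReal` loses
    -- nothing in the comparison.
    by_cases hc : 2 * I < ε
    · exact Eventually.of_forall fun n => (ha1 n).trans_lt hc
    · push Not at hc
      have : ENNReal.ofReal (2 * I - ε) < ENNReal.ofReal (2 * I) :=
        (ENNReal.ofReal_lt_ofReal_iff (by linarith)).2 (by linarith)
      filter_upwards [eventually_lt_of_lt_liminf (this.trans_le hfatou)] with n hn
      have := (ENNReal.ofReal_lt_ofReal_iff_of_nonneg (by linarith)).1 hn
      linarith
  obtain ⟨n₀, hn₀⟩ := eventually_atTop.1 key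
  refine ⟨n₀, fun n hn => ?_⟩
  rw [Real.dist_eq, sub_zero, abs_of_nonneg (ha0 n)]
  exact hn₀ n hn.le

variable {N : ℕ}

/-- A bump function at `0` with outer radius `r` and inner radius `r / 2`. -/
def bump (N : ℕ) {r : ℝ} (hr : 0 < r) : ContDiffBump (0 : Eucl N) :=
  ⟨r / 2, r, half_pos hr, half_lt_self hr⟩

/-- The mollification of `f` at scale `r`. -/
def mollify {r : ℝ} (hr : 0 < r) (f : Eucl N → ℝ) : Eucl N → ℝ :=
  (bump N hr).normed volume ⋆[ContinuousLinearMap.lsmul ℝ ℝ, volume] f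

theorem mollify_apply {r : ℝ} (hr : 0 < r) (f : Eucl N → ℝ) (x : Eucl N) :
    mollify hr f x = ∫ y, (bump N hr).normed volume (x - y) * f y := by
  rw [mollify, convolution_eq_swap]; rfl

theorem contDiff_mollify {r : ℝ} (hr : 0 < r) {f : Eucl N → ℝ} (hf : LocallyIntegrable f) :
    ContDiff ℝ 1 (mollify hr f) :=
  (bump N hr).hasCompactSupport_normed.contDiff_convolution_left _
    (bump N hr).contDiff_normed hf

theorem fderiv_mollify {r : ℝ} (hr : 0 < r) {f : Eucl N → ℝ} (hf : LocallyIntegrable f)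
    (x v : Eucl N) : fderiv ℝ (mollify hr f) x v =
      ∫ y, fderiv ℝ ((bump N hr).normed volume) (x - y) v * f y := by
  have hsupp := (bump N hr).hasCompactSupport_normed (μ := volume)
  have hd := hsupp.hasFDerivAt_convolution_left (ContinuousLinearMap.lsmul ℝ ℝ)
    ((bump N hr).contDiff_normed (n := 1)) hf x
  rw [mollify, hd.fderiv, convolution_eq_swap, ContinuousLinearMap.integral_apply]
  · rfl
  · have := (hsupp.fderiv ℝ).convolutionExists_left
      ((ContinuousLinearMap.lsmul ℝ ℝ).precompL (Eucl N))
      (((bump N hr).contDiff_normed (n := 1) (μ := volume)).continuous_fderiv one_ne_zero) hf x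
    exact this.integrable_swap

theorem integrable_mollify {r : ℝ} (hr : 0 < r) {f : Eucl N → ℝ} (hf : Integrable f) :
    Integrable (mollify hr f) :=
  (bump N hr).integrable_normed.integrable_convolution _ hf

theorem ae_tendsto_mollify {r : ℕ → ℝ} (hr : ∀ n, 0 < r n) (hr0 : Tendsto r atTop (𝓝 0))
    {f : Eucl N → ℝ} (hf : Integrable f) :
    ∀ᵐ x, Tendsto (fun n => mollify (hr n) f x) atTop (𝓝 (f x)) :=
  ContDiffBump.ae_convolution_tendsto_right_of_locallyIntegrable (K := 2) hr0
    (Eventually.of_forall fun n => by simp [bump]; linarith) hf.locallyIntegrable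

/-- The mollifications of |f| dominate those of f and all have the integral of |f|, the kernel
having mass 1. Almost everywhere convergence is Lebesgue differentiation. -/
theorem tendsto_integral_mollify_sub {r : ℕ → ℝ} (hr : ∀ n, 0 < r n)
    (hr0 : Tendsto r atTop (𝓝 0)) {f : Eucl N → ℝ} (hf : Integrable f) :
    Tendsto (fun n => ∫ x, |mollify (hr n) f x - f x|) atTop (𝓝 0) := by
  refine tendsto_integral_abs_sub_of_dominating (G := fun n => mollify (hr n) fun x => |f x|) hf
    (fun n => integrable_mollify _ hf) (fun n => integrable_mollify _ hf.abs) (fun n => ?_)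
    (ae_tendsto_mollify hr hr0 hf) (ae_tendsto_mollify hr hr0 hf.abs) (fun n => ?_)
  · refine Eventually.of_forall fun x => ?_
    rw [mollify_apply, mollify_apply]
    refine (abs_integral_le_integral_abs).trans (le_of_eq ?_)
    congr 1; funext y
    rw [abs_mul, abs_of_nonneg ((bump N (hr n)).nonneg_normed _)]
  · rw [mollify, integral_convolution _ (bump N (hr n)).integrable_normed hf.abs]
    rw [(bump N (hr n)).integral_normed]
    simp

end RelativeCapacity
end

/-! ### C¹ contractions and the chain rule for weak derivatives. -/

noncomputable section

namespace RelativeCapacity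

open Filter Topology
open scoped Convolution

/-- `T` is continuously differentiable with derivative `T'` taking values in `[0, 1]`, and
`T 0 = 0`. -/
structure SmoothContraction (T T' : ℝ → ℝ) : Prop where
  hasDerivAt : ∀ t, HasDerivAt T (T' t) t
  continuous_deriv : Continuous T'
  deriv_nonneg : ∀ t, 0 ≤ T' t
  deriv_le_one : ∀ t, T' t ≤ 1
  map_zero : T 0 = 0

namespace SmoothContraction

variable {T T' : ℝ → ℝ}

theorem abs_deriv_le (h : SmoothContraction T T') (t : ℝ) : |T' t| ≤ 1 := by
  rw [abs_of_nonneg (h.deriv_nonneg t)]; exact h.deriv_le_one t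

theorem continuous (h : SmoothContraction T T') : Continuous T :=
  continuous_iff_continuousAt.2 fun t => (h.hasDerivAt t).continuousAt

theorem contDiff (h : SmoothContraction T T') : ContDiff ℝ 1 T := by
  rw [contDiff_one_iff_deriv]
  refine ⟨fun t => (h.hasDerivAt t).differentiableAt, ?_⟩
  have : deriv T = T' := funext fun t => (h.hasDerivAt t).deriv
  rw [this]; exact h.continuous_deriv

theorem abs_sub_le (h : SmoothContraction T T') (s t : ℝ) : |T s - T t| ≤ |s - t| := by
  have := Convex.norm_image_sub_le_of_norm_hasDerivWithin_le (f := T) (f' := T') (C := 1)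
    (s := univ) (x := t) (y := s)
    (fun x _ => (h.hasDerivAt x).hasDerivWithinAt) (fun x _ => h.abs_deriv_le x) convex_univ
    (mem_univ _) (mem_univ _)
  simpa using this

theorem abs_le (h : SmoothContraction T T') (t : ℝ) : |T t| ≤ |t| := by
  simpa [h.map_zero] using h.abs_sub_le t 0

theorem monotone (h : SmoothContraction T T') : Monotone T :=
  monotone_of_deriv_nonneg (fun t => (h.hasDerivAt t).differentiableAt)
    fun t => by rw [(h.hasDerivAt t).deriv]; exact h.deriv_nonneg t

end SmoothContraction

variable {N : ℕ}

/-- The reflected kernel y ↦ ρ(x - y) is a test function supported in the ball, hence in `K` and in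
`Ω`. The sign produced by the reflection cancels the one in the definition of weak derivative. The
indicator only serves to make `u` integrable on the whole space. -/
theorem fderiv_mollify_indicator {Ω K : Set (Eucl N)} {i : Fin N}
    {u g : Eucl N → ℝ} (h : IsWeakPartial Ω i u g) (hK : MeasurableSet K)
    (hKΩ : K ⊆ Ω) (hu : IntegrableOn u K) {r : ℝ} (hr : 0 < r) {x : Eucl N}
    (hx : Metric.closedBall x r ⊆ K) :
    fderiv ℝ (mollify hr (K.indicator u)) x (EuclideanSpace.single i 1) =
      mollify hr (K.indicator g) x := by
  set ρ := (bump N hr).normed (volume : Measure (Eucl N)) with hρ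
  set ψ : Eucl N → ℝ := fun y => ρ (x - y) with hψ
  have hρs : ContDiff ℝ (⊤ : ℕ∞) ρ := (bump N hr).contDiff_normed
  have hψs : ContDiff ℝ (⊤ : ℕ∞) ψ := hρs.comp (contDiff_const.sub contDiff_id)
  have hsupp : ∀ y, y ∉ Metric.closedBall x r → ∀ᶠ z in 𝓝 y, ψ z = 0 := fun y hy => by
    filter_upwards [Metric.isClosed_closedBall.isOpen_compl.mem_nhds hy] with z hz
    by_contra hne
    have : x - z ∈ Function.support ρ := hne
    rw [hρ, (bump N hr).support_normed_eq, mem_ball_zero_iff] at this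
    apply hz
    rw [Metric.mem_closedBall, dist_comm, dist_eq_norm]
    exact this.le
  have hψsub : tsupport ψ ⊆ Metric.closedBall x r := by
    intro y hy
    by_contra hne
    exact (notMem_tsupport_iff_eventuallyEq.2 (hsupp y hne)) hy
  have hψc : HasCompactSupport ψ :=
    (isCompact_closedBall x r).of_isClosed_subset (isClosed_tsupport ψ) hψsub
  have hfd : ∀ y v, fderiv ℝ ψ y v = - fderiv ℝ ρ (x - y) v := fun y v => by
    have h1 : HasFDerivAt (fun y : Eucl N => x - y) (-ContinuousLinearMap.id ℝ (Eucl N)) y :=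
      (hasFDerivAt_id y).const_sub x
    have h2 := ((hρs.differentiable (by simp)) (x - y)).hasFDerivAt.comp y h1
    have : fderiv ℝ ψ y = _ := h2.fderiv
    rw [this]; simp
  have hKz : ∀ (w : Eucl N → ℝ) (y : Eucl N), (y ∉ K → w y = 0) → ∀ f : Eucl N → ℝ,
      w y * K.indicator f y = w y * f y := fun w y hw f => by
    by_cases hy : y ∈ K
    · rw [indicator_of_mem hy]
    · rw [hw hy]; simp
  have hψ0 : ∀ y ∉ K, ψ y = 0 := fun y hy => (hsupp y fun hc => hy (hx hc)).self_of_nhds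
  have hψ1 : ∀ y ∉ K, fderiv ℝ ψ y (EuclideanSpace.single i 1) = 0 := fun y hy => by
    have : ψ =ᶠ[𝓝 y] fun _ => 0 := hsupp y fun hc => hy (hx hc)
    rw [this.fderiv_eq]; simp
  have hset : ∀ w : Eucl N → ℝ, (∀ y ∉ K, w y = 0) → ∫ y in Ω, w y = ∫ y, w y := fun w hw =>
    setIntegral_eq_integral_of_forall_compl_eq_zero fun y hy => hw y fun hc => hy (hKΩ hc)
  rw [fderiv_mollify hr ((integrable_indicator_iff hK).2 hu).locallyIntegrable, mollify_apply]
  have e := h ψ hψs hψc (hψsub.trans (hx.trans hKΩ))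
  rw [hset _ (fun y hy => by rw [hψ1 y hy, mul_zero]),
    hset _ (fun y hy => by rw [hψ0 y hy, mul_zero])] at e
  calc ∫ y, fderiv ℝ ρ (x - y) (EuclideanSpace.single i 1) * K.indicator u y
      = ∫ y, -(u y * fderiv ℝ ψ y (EuclideanSpace.single i 1)) := by
        congr 1; funext y
        rw [hKz (fun y => fderiv ℝ ρ (x - y) (EuclideanSpace.single i 1)) y
          (fun hy => by have := hψ1 y hy; rw [hfd] at this; linarith), hfd]
        ring
    _ = ∫ y, g y * ψ y := by rw [integral_neg, e, neg_neg]
    _ = _ := by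
        congr 1; funext y
        rw [hKz ψ y (hψ0 y), mul_comm]

/-- On a compact neighbourhood of the support of the test function, `u` and `g` are replaced by
mollifications. There the classical chain rule and integration by parts apply, and both sides pass
to the limit. -/
theorem IsWeakPartial.comp {Ω : Set (Eucl N)} (hΩ : IsOpen Ω) {i : Fin N} {u g : Eucl N → ℝ}
    (h : IsWeakPartial Ω i u g) (hu : LocallyIntegrableOn u Ω) (hg : LocallyIntegrableOn g Ω)
    {T T' : ℝ → ℝ} (hT : SmoothContraction T T') :
    IsWeakPartial Ω i (fun x => T (u x)) (fun x => T' (u x) * g x) := by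
  intro φ hφ hφc hφΩ
  obtain ⟨r, hr, hrΩ⟩ := hφc.isCompact.exists_cthickening_subset_open hΩ hφΩ
  set K := Metric.cthickening r (tsupport φ) with hKdef
  have hKc : IsCompact K := hφc.isCompact.cthickening
  have hKm : MeasurableSet K := hKc.measurableSet
  have hKφ : tsupport φ ⊆ K := Metric.self_subset_cthickening _
  have huK : IntegrableOn u K := hu.integrableOn_compact_subset hrΩ hKc
  have hgK : IntegrableOn g K := hg.integrableOn_compact_subset hrΩ hKc
  set v := K.indicator u with hv
  set w := K.indicator g with hw
  have hvi : Integrable v := (integrable_indicator_iff hKm).2 huK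
  have hwi : Integrable w := (integrable_indicator_iff hKm).2 hgK
  -- The scales stay at most `r`, so that every ball of radius `s n` about a point of the support of
  -- `φ` lies in `K`.
  set s : ℕ → ℝ := fun n => r / (n + 1) with hs
  have hspos : ∀ n, 0 < s n := fun n => by positivity
  have hs0 : Tendsto s atTop (𝓝 0) := tendsto_const_div_atTop_nhds_zero_nat r |>.comp
    (tendsto_add_atTop_nat 1) |>.congr fun n => by simp [hs]
  have hsr : ∀ n, s n ≤ r := fun n => div_le_self hr.le (by linarith [n.cast_nonneg (α := ℝ)])
  set V : ℕ → Eucl N → ℝ := fun n => mollify (hspos n) v with hV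
  set W : ℕ → Eucl N → ℝ := fun n => mollify (hspos n) w with hW
  set e : Eucl N := EuclideanSpace.single i 1 with he
  set dφ : Eucl N → ℝ := fun x => fderiv ℝ φ x e with hdφ
  have hφcont : Continuous φ := hφ.continuous
  have hdφcont : Continuous dφ := (hφ.continuous_fderiv (by simp)).clm_apply continuous_const
  have hdφ0 : ∀ x ∉ tsupport φ, dφ x = 0 := fun x hx => by
    have : fderiv ℝ φ x = 0 := by
      by_contra hne
      exact hx (support_fderiv_subset ℝ hne)
    simp [hdφ, this]
  have hφ0 : ∀ x ∉ tsupport φ, φ x = 0 := fun x hx => image_eq_zero_of_notMem_tsupport hx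
  have hdφc : HasCompactSupport dφ := HasCompactSupport.intro hφc.isCompact hdφ0
  obtain ⟨C, hC⟩ := hφc.exists_bound_of_continuous hφcont
  obtain ⟨D, hD⟩ := hdφc.exists_bound_of_continuous hdφcont
  have hD0 : 0 ≤ D := (norm_nonneg _).trans (hD 0)
  have hC0 : 0 ≤ C := (norm_nonneg _).trans (hC 0)
  have hVs : ∀ n, ContDiff ℝ 1 (V n) := fun n => contDiff_mollify _ hvi.locallyIntegrable
  have hWcont : ∀ n, Continuous (W n) := fun n =>
    (contDiff_mollify _ hwi.locallyIntegrable).continuous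
  have hTm : ∀ {f : Eucl N → ℝ}, AEStronglyMeasurable f volume →
      AEStronglyMeasurable (fun x => T (f x)) volume := fun hf =>
    hT.continuous.comp_aestronglyMeasurable hf
  have hT'm : ∀ {f : Eucl N → ℝ}, AEStronglyMeasurable f volume →
      AEStronglyMeasurable (fun x => T' (f x)) volume := fun hf =>
    hT.continuous_deriv.comp_aestronglyMeasurable hf
  have hibp : ∀ n, ∫ x, T (V n x) * dφ x = - ∫ x, T' (V n x) * W n x * φ x := by
    intro n
    have hTV : ContDiff ℝ 1 (fun x => T (V n x)) := hT.contDiff.comp (hVs n)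
    have hfd : ∀ x, fderiv ℝ (fun x => T (V n x)) x e = T' (V n x) * fderiv ℝ (V n) x e := by
      intro x
      have := (hT.hasDerivAt (V n x)).comp_hasFDerivAt x
        ((hVs n).differentiable one_ne_zero x).hasFDerivAt
      have e' : fderiv ℝ (fun x => T (V n x)) x = _ := this.fderiv
      rw [e']; simp
    have key := integral_mul_fderiv_eq_neg_fderiv_mul_of_integrable (μ := volume)
      (f := fun x => T (V n x)) (g := φ) (v := e)
      (((hTV.continuous_fderiv one_ne_zero).clm_apply continuous_const).mul hφcont
        |>.integrable_of_hasCompactSupport hφc.mul_left)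
      ((hTV.continuous.mul hdφcont).integrable_of_hasCompactSupport hdφc.mul_left)
      ((hTV.continuous.mul hφcont).integrable_of_hasCompactSupport hφc.mul_left)
      (fun x _ => hTV.differentiable one_ne_zero x)
      (fun x _ => hφ.differentiable (by simp) x)
    rw [key]
    congr 2; funext x
    by_cases hx : x ∈ tsupport φ
    · rw [hfd, fderiv_mollify_indicator h hKm hrΩ huK (hspos n)
        ((Metric.closedBall_subset_closedBall (hsr n)).trans
          (Metric.closedBall_subset_cthickening hx r))]
    · rw [hφ0 x hx, mul_zero, mul_zero]
  have hL : Tendsto (fun n => ∫ x, T (V n x) * dφ x) atTop (𝓝 (∫ x, T (v x) * dφ x)) := by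
    have hTvi : ∀ {f : Eucl N → ℝ}, Integrable f → Integrable (fun x => T (f x) * dφ x) :=
      fun {f} hf => by
        refine (hf.norm.mul_const D).mono'
          ((hTm hf.aestronglyMeasurable).mul hdφcont.aestronglyMeasurable) ?_
        refine Eventually.of_forall fun x => ?_
        rw [norm_mul]
        exact mul_le_mul (hT.abs_le _) (hD x) (norm_nonneg _) (norm_nonneg _)
    have hVi : ∀ n, Integrable (V n) := fun n => integrable_mollify _ hvi
    rw [tendsto_iff_dist_tendsto_zero]
    have hz := (tendsto_integral_mollify_sub hspos hs0 hvi).mul_const D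
    rw [zero_mul] at hz
    refine squeeze_zero (fun _ => dist_nonneg) (fun n => ?_) hz
    rw [Real.dist_eq, ← integral_sub (hTvi (hVi n)) (hTvi hvi), ← integral_mul_const]
    refine abs_integral_le_integral_abs.trans ?_
    refine integral_mono ((hTvi (hVi n)).sub (hTvi hvi)).abs
      (((hVi n).sub hvi).abs.mul_const D) fun x => ?_
    simp only
    rw [← sub_mul, abs_mul]
    exact mul_le_mul (hT.abs_sub_le _ _) (hD x) (abs_nonneg _) (abs_nonneg _)
  have hR : Tendsto (fun n => ∫ x, T' (V n x) * W n x * φ x) atTop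
      (𝓝 (∫ x, T' (v x) * w x * φ x)) := by
    have hib : ∀ {a b : Eucl N → ℝ}, AEStronglyMeasurable a volume → Integrable b →
        Integrable (fun x => T' (a x) * b x * φ x) := fun {a b} ha hb => by
      refine (hb.norm.mul_const C).mono' (((hT'm ha).mul hb.aestronglyMeasurable).mul
        hφcont.aestronglyMeasurable) (Eventually.of_forall fun x => ?_)
      rw [norm_mul, norm_mul]
      refine mul_le_mul ?_ (hC x) (norm_nonneg _) (norm_nonneg _)
      exact mul_le_of_le_one_left (norm_nonneg _) (hT.abs_deriv_le _)
    have hWi : ∀ n, Integrable (W n) := fun n => integrable_mollify _ hwi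
    have hVm : ∀ n, AEStronglyMeasurable (V n) volume :=
      fun n => (hVs n).continuous.aestronglyMeasurable
    -- The product is split: with `w` fixed, a.e. convergence of `V n` and continuity of `T'` allow
    -- dominated convergence; replacing `W n` by `w` costs at most C times their L¹ distance, as
    -- |T'| ≤ 1.
    have h1 : Tendsto (fun n => ∫ x, T' (V n x) * w x * φ x) atTop
        (𝓝 (∫ x, T' (v x) * w x * φ x)) := by
      refine tendsto_integral_of_dominated_convergence (fun x => ‖w x‖ * C)
        (fun n => (hib (hVm n) hwi).aestronglyMeasurable) (hwi.norm.mul_const C)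
        (fun n => Eventually.of_forall fun x => ?_) ?_
      · rw [norm_mul, norm_mul]
        refine mul_le_mul ?_ (hC x) (norm_nonneg _) (norm_nonneg _)
        exact mul_le_of_le_one_left (norm_nonneg _) (hT.abs_deriv_le _)
      · filter_upwards [ae_tendsto_mollify hspos hs0 hvi] with x hx
        exact (((hT.continuous_deriv.tendsto _).comp hx).mul_const _).mul_const _
    have h2 : Tendsto (fun n => (∫ x, T' (V n x) * W n x * φ x) - ∫ x, T' (V n x) * w x * φ x)
        atTop (𝓝 0) := by
      have hz := (tendsto_integral_mollify_sub hspos hs0 hwi).mul_const C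
      rw [zero_mul] at hz
      refine squeeze_zero_norm (fun n => ?_) hz
      rw [← integral_sub (hib (hVm n) (hWi n)) (hib (hVm n) hwi), ← integral_mul_const]
      refine abs_integral_le_integral_abs.trans ?_
      refine integral_mono ((hib (hVm n) (hWi n)).sub (hib (hVm n) hwi)).abs
        (((hWi n).sub hwi).abs.mul_const C) fun x => ?_
      simp only
      rw [← sub_mul, ← mul_sub, abs_mul, abs_mul]
      refine mul_le_mul ?_ (hC x) (abs_nonneg _) (abs_nonneg _)
      exact mul_le_of_le_one_left (abs_nonneg _) (hT.abs_deriv_le _)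
    simpa using h2.add h1
  have hfinal := tendsto_nhds_unique (hL.congr hibp) hR.neg
  have hset : ∀ f : Eucl N → ℝ, (∀ y ∉ tsupport φ, f y = 0) → ∫ y in Ω, f y = ∫ y, f y :=
    fun f hf => setIntegral_eq_integral_of_forall_compl_eq_zero
      fun y hy => hf y fun hc => hy (hφΩ hc)
  rw [hset _ (fun x hx => by rw [show fderiv ℝ φ x e = dφ x from rfl,
      hdφ0 x hx, mul_zero]), hset _ (fun x hx => by rw [hφ0 x hx, mul_zero])]
  convert hfinal using 1
  · congr 1; funext x
    by_cases hx : x ∈ tsupport φ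
    · rw [hv, indicator_of_mem (hKφ hx)]
    · rw [hdφ0 x hx, show fderiv ℝ φ x e = dφ x from rfl, hdφ0 x hx]; simp
  · congr 2; funext x
    by_cases hx : x ∈ tsupport φ
    · rw [hv, hw, indicator_of_mem (hKφ hx), indicator_of_mem (hKφ hx)]
    · rw [hφ0 x hx]; simp

end RelativeCapacity
end

/-! ### Sobolev spaces as closed subspaces, and composition with contractions. -/

noncomputable section

namespace RelativeCapacity

open Filter Topology

/-- Integration against a continuous function with compact support, as a functional on `L^p`. -/
theorem exists_clm_integral_mul {N : ℕ} (p : ℝ≥0∞) [hp : Fact (1 ≤ p)] (Ω : Set (Eucl N))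
    {h : Eucl N → ℝ} (hc : Continuous h) (hs : HasCompactSupport h) :
    ∃ ℓ : Lp ℝ p (volume.restrict Ω) →L[ℝ] ℝ, ∀ f, ℓ f = ∫ x in Ω, f x * h x := by
  have : ENNReal.HolderConjugate p (ENNReal.conjExponent p) := .conjExponent hp.out
  have : Fact (1 ≤ ENNReal.conjExponent p) := ⟨ENNReal.HolderTriple.le _ p 1⟩
  have hm : MemLp h (ENNReal.conjExponent p) (volume.restrict Ω) :=
    (hc.memLp_of_hasCompactSupport hs).restrict Ω
  refine ⟨((ContinuousLinearMap.mul ℝ ℝ).lpPairing (volume.restrict Ω) p _).flip (hm.toLp h),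
    fun f => ?_⟩
  rw [ContinuousLinearMap.flip_apply, ContinuousLinearMap.lpPairing_eq_integral]
  refine integral_congr_ae ?_
  filter_upwards [hm.coeFn_toLp] with x hx
  simp [hx]

theorem tendsto_eLpNorm_mul_zero {α : Type*} [MeasurableSpace α] {μ : Measure α} {p : ℝ≥0∞}
    (hp0 : p ≠ 0) (hp : p ≠ ∞) {a : ℕ → α → ℝ} {H : α → ℝ} (hH : MemLp H p μ)
    (ha : ∀ n, AEStronglyMeasurable (a n) μ) (ha1 : ∀ n x, |a n x| ≤ 1)
    (ha0 : ∀ᵐ x ∂μ, Tendsto (fun n => a n x) atTop (𝓝 0)) :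
    Tendsto (fun n => eLpNorm (fun x => a n x * H x) p μ) atTop (𝓝 0) := by
  have hpr : 0 < p.toReal := ENNReal.toReal_pos hp0 hp
  simp_rw [eLpNorm_eq_lintegral_rpow_enorm_toReal hp0 hp]
  have key : Tendsto (fun n => ∫⁻ x, ‖a n x * H x‖ₑ ^ p.toReal ∂μ) atTop (𝓝 (∫⁻ x, 0 ∂μ)) := by
    refine tendsto_lintegral_of_dominated_convergence' (fun x => ‖H x‖ₑ ^ p.toReal)
      (fun n => ((ha n).mul hH.aestronglyMeasurable).enorm.pow_const _)
      (fun n => Eventually.of_forall fun x => ?_)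
      (lintegral_rpow_enorm_lt_top_of_eLpNorm_lt_top hp0 hp hH.2).ne ?_
    · refine ENNReal.rpow_le_rpow ?_ hpr.le
      rw [enorm_le_iff_norm_le, norm_mul]
      exact mul_le_of_le_one_left (norm_nonneg _) (ha1 n x)
    · filter_upwards [ha0] with x hx
      have h1 : Tendsto (fun n => ‖a n x * H x‖ₑ) atTop (𝓝 0) := by
        have := (continuous_enorm.tendsto _).comp (hx.mul_const (H x))
        rwa [zero_mul, enorm_zero] at this
      have := (ENNReal.continuous_rpow_const (y := p.toReal)).tendsto 0 |>.comp h1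
      rwa [ENNReal.zero_rpow_of_pos hpr] at this
  have := (ENNReal.continuous_rpow_const (y := 1 / p.toReal)).tendsto _ |>.comp key
  rwa [lintegral_zero, ENNReal.zero_rpow_of_pos (one_div_pos.2 hpr)] at this

variable {N : ℕ} {p : ℝ≥0∞} {Ω : Set (Eucl N)}

theorem isCcClosure_add {f g : Eucl N → ℝ} (hf : IsCcClosure Ω f) (hg : IsCcClosure Ω g) :
    IsCcClosure Ω (fun x => f x + g x) := by
  obtain ⟨hf1, K, hK, hf2⟩ := hf
  obtain ⟨hg1, L, hL, hg2⟩ := hg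
  refine ⟨hf1.add hg1, K ∪ L, hK.union hL, fun x hx => ?_⟩
  beta_reduce
  rw [hf2 x ⟨hx.1, fun h => hx.2 (Or.inl h)⟩, hg2 x ⟨hx.1, fun h => hx.2 (Or.inr h)⟩, add_zero]

theorem isCcClosure_comp {f : Eucl N → ℝ} (hf : IsCcClosure Ω f) {T : ℝ → ℝ}
    (hT : Continuous T) (hT0 : T 0 = 0) : IsCcClosure Ω (fun x => T (f x)) := by
  obtain ⟨hf1, K, hK, hf2⟩ := hf
  exact ⟨hT.comp_continuousOn hf1, K, hK, fun x hx => by beta_reduce; rw [hf2 x hx, hT0]⟩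

theorem coeFn_add_none (U V : LpJet p Ω) :
    ∀ᵐ x ∂volume.restrict Ω, (U + V) none x = U none x + V none x :=
  Lp.coeFn_add (U none) (V none)

theorem coeFn_sub_none (U V : LpJet p Ω) :
    ∀ᵐ x ∂volume.restrict Ω, (U - V) none x = U none x - V none x :=
  Lp.coeFn_sub (U none) (V none)

theorem coeFn_smul_none (c : ℝ) (U : LpJet p Ω) :
    ∀ᵐ x ∂volume.restrict Ω, (c • U) none x = c * U none x :=
  Lp.coeFn_smul c (U none)

theorem memLp_comp {T T' : ℝ → ℝ} (hT : SmoothContraction T T') (u : Lp ℝ p (volume.restrict Ω)) :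
    MemLp (fun x => T (u x)) p (volume.restrict Ω) :=
  (Lp.memLp u).mono (hT.continuous.comp_aestronglyMeasurable (Lp.aestronglyMeasurable u))
    (Eventually.of_forall fun _ => hT.abs_le _)

theorem memLp_deriv_mul {T T' : ℝ → ℝ} (hT : SmoothContraction T T') (u g : Lp ℝ p (volume.restrict Ω)) :
    MemLp (fun x => T' (u x) * g x) p (volume.restrict Ω) :=
  (Lp.memLp g).mono ((hT.continuous_deriv.comp_aestronglyMeasurable
    (Lp.aestronglyMeasurable u)).mul (Lp.aestronglyMeasurable g))
    (Eventually.of_forall fun _ => by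
      rw [norm_mul]; exact mul_le_of_le_one_left (norm_nonneg _) (hT.abs_deriv_le _))

/-- The composition of a Sobolev function with a smooth contraction. -/
def compJet {T T' : ℝ → ℝ} (hT : SmoothContraction T T') (U : LpJet p Ω) : LpJet p Ω :=
  WithLp.toLp p fun j => match j with
    | none => (memLp_comp hT (U none)).toLp
    | some i => (memLp_deriv_mul hT (U none) (U (some i))).toLp

theorem coeFn_compJet_none {T T' : ℝ → ℝ} (hT : SmoothContraction T T') (U : LpJet p Ω) :
    ∀ᵐ x ∂volume.restrict Ω, compJet hT U none x = T (U none x) :=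
  (memLp_comp hT (U none)).coeFn_toLp

theorem coeFn_compJet_some {T T' : ℝ → ℝ} (hT : SmoothContraction T T') (U : LpJet p Ω) (i : Fin N) :
    ∀ᵐ x ∂volume.restrict Ω, compJet hT U (some i) x = T' (U none x) * U (some i) x :=
  (memLp_deriv_mul hT (U none) (U (some i))).coeFn_toLp

variable [hp1 : Fact (1 ≤ p)]

/-- Exhibits the Sobolev space as an intersection of kernels of continuous functionals, one for each
test function and direction; linearity and closedness follow together. -/
theorem exists_clm_eq_zero_iff_integral_eq (i : Fin N) {φ : Eucl N → ℝ}
    (hφ : ContDiff ℝ (⊤ : ℕ∞) φ) (hφc : HasCompactSupport φ) :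
    ∃ ℓ : LpJet p Ω →L[ℝ] ℝ, ∀ U : LpJet p Ω, ℓ U = 0 ↔
      ∫ x in Ω, U none x * fderiv ℝ φ x (EuclideanSpace.single i 1) =
        - ∫ x in Ω, U (some i) x * φ x := by
  obtain ⟨ℓ₁, h₁⟩ := exists_clm_integral_mul p Ω
    (h := fun x => fderiv ℝ φ x (EuclideanSpace.single i 1))
    ((hφ.continuous_fderiv (by simp)).clm_apply continuous_const)
    (hφc.fderiv_apply ℝ _)
  obtain ⟨ℓ₂, h₂⟩ := exists_clm_integral_mul p Ω hφ.continuous hφc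
  refine ⟨ℓ₁.comp (PiLp.proj p _ none) + ℓ₂.comp (PiLp.proj p _ (some i)), fun U => ?_⟩
  rw [eq_neg_iff_add_eq_zero, ← h₁, ← h₂]
  rfl

variable (p Ω) in
/-- The Sobolev space as a closed subspace. -/
theorem exists_sobolev_submodule : ∃ S : Submodule ℝ (LpJet p Ω),
    (S : Set (LpJet p Ω)) = sobolev p Ω ∧ IsClosed (S : Set (LpJet p Ω)) := by
  let ι := {q : Fin N × (Eucl N → ℝ) //
    ContDiff ℝ (⊤ : ℕ∞) q.2 ∧ HasCompactSupport q.2 ∧ tsupport q.2 ⊆ Ω}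
  choose ℓ hℓ using fun q : ι => exists_clm_eq_zero_iff_integral_eq (p := p) (Ω := Ω) q.1.1 q.2.1 q.2.2.1
  refine ⟨⨅ q : ι, LinearMap.ker (ℓ q : LpJet p Ω →ₗ[ℝ] ℝ), ?_, ?_⟩
  · ext U
    simp only [Submodule.coe_iInf, mem_iInter, SetLike.mem_coe, LinearMap.mem_ker]
    constructor
    · intro h i φ hφ hφc hφΩ
      exact (hℓ ⟨(i, φ), hφ, hφc, hφΩ⟩ U).1 (h _)
    · intro h q
      exact (hℓ q U).2 (h q.1.1 q.1.2 q.2.1 q.2.2.1 q.2.2.2)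
  · rw [Submodule.coe_iInf]
    exact isClosed_iInter fun q => (ℓ q).isClosed_ker

variable (p Ω) in
/-- The space `W^{1,p}(Ω)` as a submodule. -/
def sobolevSubmodule : Submodule ℝ (LpJet p Ω) := (exists_sobolev_submodule p Ω).choose

theorem mem_sobolevSubmodule {U : LpJet p Ω} : U ∈ sobolevSubmodule p Ω ↔ U ∈ sobolev p Ω := by
  rw [← (exists_sobolev_submodule p Ω).choose_spec.1]; rfl

variable (p Ω) in
theorem isClosed_sobolev : IsClosed (sobolev p Ω) := by
  rw [← (exists_sobolev_submodule p Ω).choose_spec.1]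
  exact (exists_sobolev_submodule p Ω).choose_spec.2

variable (p Ω) in
/-- `W^{1,p}(Ω) ∩ C_c(closure Ω)` as a submodule. -/
def sobolevCcSubmodule : Submodule ℝ (LpJet p Ω) where
  carrier := sobolevCc p Ω
  zero_mem' := ⟨mem_sobolevSubmodule.1 (zero_mem _), fun _ => 0,
    ⟨continuousOn_const, ∅, isCompact_empty, fun _ _ => rfl⟩, Lp.coeFn_zero _ _ _⟩
  add_mem' := by
    rintro U V ⟨hU, f, hf, hUf⟩ ⟨hV, g, hg, hVg⟩
    refine ⟨mem_sobolevSubmodule.1 (add_mem (mem_sobolevSubmodule.2 hU)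
      (mem_sobolevSubmodule.2 hV)), _, isCcClosure_add hf hg, ?_⟩
    filter_upwards [Lp.coeFn_add (U none) (V none), hUf, hVg] with x h1 h2 h3
    rw [← h2, ← h3, ← Pi.add_apply, ← h1]; rfl
  smul_mem' := by
    rintro c U ⟨hU, f, hf, hUf⟩
    refine ⟨mem_sobolevSubmodule.1 (Submodule.smul_mem _ c (mem_sobolevSubmodule.2 hU)), _,
      isCcClosure_comp hf (T := fun t => c * t) (by fun_prop) (by simp), ?_⟩
    filter_upwards [Lp.coeFn_smul c (U none), hUf] with x h1 h2
    rw [← h2, ← smul_eq_mul, ← Pi.smul_apply, ← h1]; rfl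

variable (p Ω) in
/-- The space `W̃^{1,p}(Ω)` as a submodule. -/
def sobolevTildeSubmodule : Submodule ℝ (LpJet p Ω) :=
  (sobolevCcSubmodule p Ω).topologicalClosure

variable (p Ω) in
-- Since the Sobolev space is closed in `LpJet p Ω`, the intersection in the definition removes
-- nothing.
theorem sobolevTilde_eq_closure : sobolevTilde p Ω = closure (sobolevCc p Ω) :=
  inter_eq_left.2 (closure_minimal (fun _ h => h.1) (isClosed_sobolev p Ω))

variable (p Ω) in
theorem isClosed_sobolevTilde : IsClosed (sobolevTilde p Ω) := by
  rw [sobolevTilde_eq_closure]; exact isClosed_closure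

theorem mem_sobolevTildeSubmodule {U : LpJet p Ω} :
    U ∈ sobolevTildeSubmodule p Ω ↔ U ∈ sobolevTilde p Ω := by
  rw [sobolevTilde_eq_closure]; rfl

theorem add_mem_sobolevTilde {U V : LpJet p Ω} (hU : U ∈ sobolevTilde p Ω)
    (hV : V ∈ sobolevTilde p Ω) : U + V ∈ sobolevTilde p Ω :=
  mem_sobolevTildeSubmodule.1
    (add_mem (mem_sobolevTildeSubmodule.2 hU) (mem_sobolevTildeSubmodule.2 hV))

theorem sub_mem_sobolevTilde {U V : LpJet p Ω} (hU : U ∈ sobolevTilde p Ω)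
    (hV : V ∈ sobolevTilde p Ω) : U - V ∈ sobolevTilde p Ω :=
  mem_sobolevTildeSubmodule.1
    (sub_mem (mem_sobolevTildeSubmodule.2 hU) (mem_sobolevTildeSubmodule.2 hV))

theorem smul_mem_sobolevTilde (c : ℝ) {U : LpJet p Ω} (hU : U ∈ sobolevTilde p Ω) :
    c • U ∈ sobolevTilde p Ω :=
  mem_sobolevTildeSubmodule.1 (Submodule.smul_mem _ c (mem_sobolevTildeSubmodule.2 hU))

theorem tendsto_coord {U : ℕ → LpJet p Ω} {V : LpJet p Ω} (h : Tendsto U atTop (𝓝 V))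
    (j : Option (Fin N)) : Tendsto (fun n => U n j) atTop (𝓝 (V j)) :=
  ((PiLp.proj (𝕜 := ℝ) p (fun _ => Lp ℝ p (volume.restrict Ω)) j).continuous.tendsto V).comp h

theorem exists_subseq_ae_tendsto {U : ℕ → LpJet p Ω} {V : LpJet p Ω}
    (h : Tendsto U atTop (𝓝 V)) : ∃ ns : ℕ → ℕ, StrictMono ns ∧
      ∀ᵐ x ∂volume.restrict Ω, Tendsto (fun k => U (ns k) none x) atTop (𝓝 (V none x)) :=
  (tendstoInMeasure_of_tendsto_Lp (tendsto_coord h none)).exists_seq_tendsto_ae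

theorem norm_le_norm_of_forall_le (hp : p ≠ ∞) {U V : LpJet p Ω} (h : ∀ j, ‖U j‖ ≤ ‖V j‖) :
    ‖U‖ ≤ ‖V‖ := by
  have hpr : 0 < p.toReal :=
    ENNReal.toReal_pos (zero_lt_one.trans_le hp1.out).ne' hp
  rw [PiLp.norm_eq_sum hpr, PiLp.norm_eq_sum hpr]
  gcongr with j
  exact h j

section Comp

variable {T T' : ℝ → ℝ}

theorem norm_compJet_le (hp : p ≠ ∞) (hT : SmoothContraction T T') (U : LpJet p Ω) :
    ‖compJet hT U‖ ≤ ‖U‖ := by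
  refine norm_le_norm_of_forall_le hp fun j => Lp.norm_le_norm_of_ae_le ?_
  cases j with
  | none =>
    filter_upwards [coeFn_compJet_none hT U] with x hx
    rw [hx]; exact hT.abs_le _
  | some i =>
    filter_upwards [coeFn_compJet_some hT U i] with x hx
    rw [hx, norm_mul]; exact mul_le_of_le_one_left (norm_nonneg _) (hT.abs_deriv_le _)

theorem locallyIntegrableOn_coeFn (hΩ : IsOpen Ω) (u : Lp ℝ p (volume.restrict Ω)) :
    LocallyIntegrableOn u Ω := by
  rw [locallyIntegrableOn_iff hΩ.isLocallyClosed]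
  intro K hK hKc
  have : MemLp u p (volume.restrict K) := (Lp.memLp u).mono_measure (Measure.restrict_mono_set _ hK)
  have hfin : IsFiniteMeasure (volume.restrict K) := ⟨by simpa using hKc.measure_lt_top⟩
  exact this.integrable hp1.out

theorem compJet_mem_sobolev (hΩ : IsOpen Ω) (hT : SmoothContraction T T') {U : LpJet p Ω}
    (hU : U ∈ sobolev p Ω) : compJet hT U ∈ sobolev p Ω := by
  intro i φ hφ hφc hφΩ
  have := (hU i).comp hΩ (locallyIntegrableOn_coeFn hΩ _) (locallyIntegrableOn_coeFn hΩ _) hT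
    φ hφ hφc hφΩ
  rw [show ∫ x in Ω, compJet hT U none x * fderiv ℝ φ x (EuclideanSpace.single i 1) =
      ∫ x in Ω, T (U none x) * fderiv ℝ φ x (EuclideanSpace.single i 1) from
      integral_congr_ae (by filter_upwards [coeFn_compJet_none hT U] with x hx; rw [hx]), this,
    show ∫ x in Ω, compJet hT U (some i) x * φ x = ∫ x in Ω, T' (U none x) * U (some i) x * φ x
      from integral_congr_ae
        (by filter_upwards [coeFn_compJet_some hT U i] with x hx; rw [hx])]

/-- The difference of derivatives is T'(uₙ)(∂uₙ - ∂v) + (T'(uₙ) - T'(v))∂v. The first term is small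
in norm; the second tends to 0 by dominated convergence. Since `T'` is merely continuous, this uses
the a.e. convergence of uₙ. -/
theorem tendsto_compJet (hp : p ≠ ∞) (hT : SmoothContraction T T') {U : ℕ → LpJet p Ω}
    {V : LpJet p Ω} (h : Tendsto U atTop (𝓝 V))
    (hae : ∀ᵐ x ∂volume.restrict Ω, Tendsto (fun k => U k none x) atTop (𝓝 (V none x))) :
    Tendsto (fun n => compJet hT (U n)) atTop (𝓝 (compJet hT V)) := by
  have hp0 : p ≠ 0 := (zero_lt_one.trans_le hp1.out).ne'
  have hcoord : ∀ j, Tendsto (fun n => compJet hT (U n) j) atTop (𝓝 (compJet hT V j)) := by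
    intro j
    have hj := tendsto_coord h j
    rw [tendsto_iff_norm_sub_tendsto_zero] at hj ⊢
    cases j with
    | none =>
      refine squeeze_zero (fun _ => norm_nonneg _) (fun n => Lp.norm_le_norm_of_ae_le ?_) hj
      filter_upwards [coeFn_compJet_none hT (U n), coeFn_compJet_none hT V,
        Lp.coeFn_sub (compJet hT (U n) none) (compJet hT V none),
        Lp.coeFn_sub (U n none) (V none)] with x h1 h2 h3 h4
      rw [h3, h4, Pi.sub_apply, Pi.sub_apply, h1, h2]
      exact hT.abs_sub_le _ _
    | some i =>
      set a : ℕ → Eucl N → ℝ := fun n x => T' (U n none x) - T' (V none x) with ha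
      have ham : ∀ n, AEStronglyMeasurable (a n) (volume.restrict Ω) := fun n =>
        (hT.continuous_deriv.comp_aestronglyMeasurable (Lp.aestronglyMeasurable _)).sub
          (hT.continuous_deriv.comp_aestronglyMeasurable (Lp.aestronglyMeasurable _))
      have ha1 : ∀ n x, |a n x| ≤ 1 := fun n x => by
        have h1 := hT.deriv_nonneg (U n none x)
        have h2 := hT.deriv_le_one (U n none x)
        have h3 := hT.deriv_nonneg (V none x)
        have h4 := hT.deriv_le_one (V none x)
        rw [abs_le]; constructor <;> simp only [ha] <;> linarith
      have ha0 : ∀ᵐ x ∂volume.restrict Ω, Tendsto (fun n => a n x) atTop (𝓝 0) := by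
        filter_upwards [hae] with x hx
        have := ((hT.continuous_deriv.tendsto _).comp hx).sub_const (T' (V none x))
        simpa [ha] using this
      have hz := tendsto_eLpNorm_mul_zero hp0 hp (Lp.memLp (V (some i))) ham ha1 ha0
      have hmem : ∀ n, MemLp (fun x => a n x * V (some i) x) p (volume.restrict Ω) := fun n =>
        (Lp.memLp (V (some i))).mono ((ham n).mul (Lp.aestronglyMeasurable _))
          (Eventually.of_forall fun x => by
            rw [norm_mul]; exact mul_le_of_le_one_left (norm_nonneg _) (ha1 n x))
      have hz' : Tendsto (fun n => ‖(hmem n).toLp‖) atTop (𝓝 0) := by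
        simp_rw [Lp.norm_toLp]
        exact (ENNReal.tendsto_toReal ENNReal.zero_ne_top).comp hz
      have hm : ∀ n, MemLp (fun x => T' (U n none x) * (U n (some i) - V (some i)) x) p
          (volume.restrict Ω) := fun n => memLp_deriv_mul hT _ _
      have hsum := hj.add hz'
      rw [add_zero] at hsum
      refine squeeze_zero (fun _ => norm_nonneg _) (fun n => ?_) hsum
      have heq : compJet hT (U n) (some i) - compJet hT V (some i) =
          (hm n).toLp + (hmem n).toLp := by
        refine Lp.ext ?_
        filter_upwards [coeFn_compJet_some hT (U n) i, coeFn_compJet_some hT V i,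
          Lp.coeFn_sub (compJet hT (U n) (some i)) (compJet hT V (some i)),
          Lp.coeFn_sub (U n (some i)) (V (some i)), (hm n).coeFn_toLp, (hmem n).coeFn_toLp,
          Lp.coeFn_add (hm n).toLp (hmem n).toLp] with x h1 h2 h3 h4 h5 h6 h7
        rw [h3, h7, Pi.sub_apply, Pi.add_apply, h1, h2, h5, h6, h4, Pi.sub_apply]
        simp only [ha]; ring
      rw [heq]
      refine (norm_add_le _ _).trans (add_le_add_left (Lp.norm_le_norm_of_ae_le ?_) _)
      filter_upwards [(hm n).coeFn_toLp] with x hx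
      rw [hx, norm_mul]
      exact mul_le_of_le_one_left (norm_nonneg _) (hT.abs_deriv_le _)
  exact ((PiLp.continuous_toLp p (fun _ : Option (Fin N) => Lp ℝ p (volume.restrict Ω))).tendsto
    (WithLp.ofLp (compJet hT V))).comp (tendsto_pi_nhds.2 hcoord)

/-- `T` maps the approximating functions to functions of the same kind, the compact support being
kept because T 0 = 0; a subsequence converging a.e. makes the compositions converge. -/
theorem compJet_mem_sobolevTilde (hΩ : IsOpen Ω) (hp : p ≠ ∞) (hT : SmoothContraction T T')
    {U : LpJet p Ω} (hU : U ∈ sobolevTilde p Ω) : compJet hT U ∈ sobolevTilde p Ω := by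
  rw [sobolevTilde_eq_closure] at hU ⊢
  obtain ⟨F, hF, hFU⟩ := mem_closure_iff_seq_limit.1 hU
  obtain ⟨ns, hns, hae⟩ := exists_subseq_ae_tendsto hFU
  refine mem_closure_of_tendsto (tendsto_compJet hp hT (hFU.comp hns.tendsto_atTop) hae)
    (Eventually.of_forall fun n => ?_)
  obtain ⟨h1, f, hf, hfe⟩ := hF (ns n)
  refine ⟨compJet_mem_sobolev hΩ hT h1, _, isCcClosure_comp hf hT.continuous hT.map_zero, ?_⟩
  filter_upwards [coeFn_compJet_none hT (F (ns n)), hfe] with x h2 h3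
  simp only [Function.comp] at h2 ⊢
  rw [h2, h3]

end Comp

end RelativeCapacity
end

/-! ### The root of the capacity and its countable subadditivity. -/

noncomputable section

namespace RelativeCapacity

open Filter Topology

/-- A smooth approximation of `t ↦ max t 0`. -/
def softPos (δ t : ℝ) : ℝ := (t + √(t ^ 2 + δ ^ 2) - δ) / 2

theorem smoothContraction_softPos {δ : ℝ} (hδ : 0 < δ) :
    SmoothContraction (softPos δ) (fun t => (1 + t / √(t ^ 2 + δ ^ 2)) / 2) := by
  have hpos : ∀ t : ℝ, 0 < t ^ 2 + δ ^ 2 := fun t => by positivity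
  have hsq : ∀ t : ℝ, 0 < √(t ^ 2 + δ ^ 2) := fun t => Real.sqrt_pos.2 (hpos t)
  have habs : ∀ t : ℝ, |t / √(t ^ 2 + δ ^ 2)| ≤ 1 := fun t => by
    rw [abs_div, abs_of_pos (hsq t), div_le_one (hsq t)]
    exact Real.abs_le_sqrt (by nlinarith)
  refine ⟨fun t => ?_, ?_, fun t => ?_, fun t => ?_, ?_⟩
  · have h1 : HasDerivAt (fun t : ℝ => t ^ 2 + δ ^ 2) (2 * t) t := by
      simpa using (hasDerivAt_pow 2 t).add_const (δ ^ 2)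
    have h2 : HasDerivAt (softPos δ) _ t :=
      (((hasDerivAt_id t).add (h1.sqrt (hpos t).ne')).sub_const δ).div_const 2
    refine h2.congr_deriv ?_
    rw [mul_div_mul_left _ _ two_ne_zero]
  · refine Continuous.div_const (continuous_const.add (continuous_id.div ?_ fun t => (hsq t).ne')) 2
    fun_prop
  · have := (abs_le.1 (habs t)).1; linarith
  · have := (abs_le.1 (habs t)).2; linarith
  · simp [softPos, Real.sqrt_sq hδ.le]

theorem max_sub_le_softPos {δ : ℝ} (hδ : 0 < δ) (t : ℝ) : max t 0 - δ ≤ softPos δ t := by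
  have h1 : |t| ≤ √(t ^ 2 + δ ^ 2) := Real.abs_le_sqrt (by nlinarith)
  rw [softPos]
  rcases max_cases t 0 with ⟨h, h'⟩ | ⟨h, h'⟩
  · rw [h]; rw [abs_of_nonneg h'] at h1; linarith
  · rw [h]; rw [abs_of_neg h'] at h1; linarith

theorem softPos_le_max {δ : ℝ} (hδ : 0 < δ) (t : ℝ) : softPos δ t ≤ max t 0 := by
  have h1 : √(t ^ 2 + δ ^ 2) ≤ |t| + δ := by
    rw [Real.sqrt_le_left (by positivity)]
    nlinarith [sq_abs t, abs_nonneg t]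
  rw [softPos]
  rcases max_cases t 0 with ⟨h, h'⟩ | ⟨h, h'⟩
  · rw [h]; rw [abs_of_nonneg h'] at h1; linarith
  · rw [h]; rw [abs_of_neg h'] at h1; linarith

variable {N : ℕ} {p : ℝ≥0∞} {Ω : Set (Eucl N)}

theorem coeFn_sum_none (F : ℕ → LpJet p Ω) (n : ℕ) :
    ∀ᵐ x ∂volume.restrict Ω,
      (∑ i ∈ Finset.range n, F i) none x = ∑ i ∈ Finset.range n, F i none x := by
  induction n with
  | zero =>
    filter_upwards [Lp.coeFn_zero ℝ p (volume.restrict Ω)] with x hx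
    simpa using hx
  | succ n ih =>
    filter_upwards [ih, coeFn_add_none (∑ i ∈ Finset.range n, F i) (F n)] with x h1 h2
    rw [Finset.sum_range_succ, Finset.sum_range_succ, h2, h1]

variable [hp1 : Fact (1 ≤ p)]

variable (p Ω) in
/-- The `p`-th root of the relative capacity. -/
def capRoot (A : Set (Eucl N)) : ℝ≥0∞ := ⨅ U ∈ admissible p Ω A, ‖U‖ₑ

theorem toReal_exponent_pos (hp : p ≠ ∞) : 0 < p.toReal :=
  ENNReal.toReal_pos (zero_lt_one.trans_le hp1.out).ne' hp

/-- Raising to the power p is an order isomorphism of [0, ∞], so it commutes with infima. -/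
theorem relCap_eq_capRoot_rpow (hp : p ≠ ∞) (A : Set (Eucl N)) :
    relCap p Ω A = capRoot p Ω A ^ p.toReal := by
  have := toReal_exponent_pos hp
  rw [← ENNReal.orderIsoRpow_apply p.toReal this, capRoot, OrderIso.map_iInf]
  simp_rw [OrderIso.map_iInf]
  rfl

theorem relCap_eq_zero_iff (hp : p ≠ ∞) {A : Set (Eucl N)} :
    relCap p Ω A = 0 ↔ capRoot p Ω A = 0 := by
  rw [relCap_eq_capRoot_rpow hp, ENNReal.rpow_eq_zero_iff_of_pos (toReal_exponent_pos hp)]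

theorem capRoot_le_of_mem {A : Set (Eucl N)} {U : LpJet p Ω} (hU : U ∈ admissible p Ω A) :
    capRoot p Ω A ≤ ‖U‖ₑ := iInf₂_le U hU

theorem exists_admissible_lt {A : Set (Eucl N)} {c : ℝ≥0∞} (h : capRoot p Ω A < c) :
    ∃ U ∈ admissible p Ω A, ‖U‖ₑ < c := by
  simpa [capRoot, iInf_lt_iff] using h

theorem admissible_anti {A B : Set (Eucl N)} (h : A ⊆ B) :
    admissible p Ω B ⊆ admissible p Ω A :=
  fun _ ⟨h1, V, hV, hBV, hae⟩ => ⟨h1, V, hV, h.trans hBV, hae⟩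

theorem capRoot_mono {A B : Set (Eucl N)} (h : A ⊆ B) : capRoot p Ω A ≤ capRoot p Ω B :=
  le_iInf₂ fun _ hU => capRoot_le_of_mem (admissible_anti h hU)

theorem capRoot_eq_zero_of_subset {A B : Set (Eucl N)} (h : A ⊆ B) (hB : capRoot p Ω B = 0) :
    capRoot p Ω A = 0 :=
  le_antisymm ((capRoot_mono h).trans hB.le) zero_le

theorem zero_mem_sobolevTilde : (0 : LpJet p Ω) ∈ sobolevTilde p Ω :=
  mem_sobolevTildeSubmodule.1 (zero_mem _)

theorem capRoot_empty : capRoot p Ω ∅ = 0 := by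
  refine le_antisymm ((capRoot_le_of_mem (U := 0) ⟨zero_mem_sobolevTilde, ∅, isOpen_empty,
    subset_rfl, by simp⟩).trans (by simp)) zero_le

theorem ae_inter_of_ae {O : Set (Eucl N)} {P : Eucl N → Prop}
    (h : ∀ᵐ x ∂volume.restrict Ω, P x) : ∀ᵐ x ∂volume.restrict (O ∩ Ω), P x :=
  ae_mono (Measure.restrict_mono_set _ inter_subset_right) h

theorem sum_mem_sobolevTilde {F : ℕ → LpJet p Ω} (hF : ∀ i, F i ∈ sobolevTilde p Ω) (n : ℕ) :
    ∑ i ∈ Finset.range n, F i ∈ sobolevTilde p Ω :=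
  mem_sobolevTildeSubmodule.1
    (Submodule.sum_mem _ fun i _ => mem_sobolevTildeSubmodule.2 (hF i))

/-- The smooth substitute for the lattice inequality: a countable family of functions, one of which
is at least `1` at almost every point of an open set, bounds the capacity of that set. -/
theorem capRoot_le_tsum (hΩ : IsOpen Ω) (hp : p ≠ ∞) {U : ℕ → LpJet p Ω}
    (hU : ∀ i, U i ∈ sobolevTilde p Ω) {O : Set (Eucl N)} (hO : IsOpen O)
    (h : ∀ᵐ x ∂volume.restrict (O ∩ Ω), ∃ i, 1 ≤ U i none x) :
    capRoot p Ω O ≤ ∑' i, ‖U i‖ₑ := by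
  by_cases htop : ∑' i, ‖U i‖ₑ = ∞
  · rw [htop]; exact le_top
  have hsumm : Summable fun i => ‖U i‖ := by
    have := ENNReal.summable_toReal htop
    simpa using this
  have key : ∀ δ : ℝ, 0 < δ → δ < 1 →
      capRoot p Ω O ≤ ENNReal.ofReal (1 - δ)⁻¹ * ∑' i, ‖U i‖ₑ := by
    intro δ hδ hδ1
    -- The smoothing errors add up to `δ`, so the sum of the smoothed positive parts is at least 1 -
    -- δ wherever some U i is at least 1. Dividing by 1 - δ gives an admissible function.
    set d : ℕ → ℝ := fun i => δ / 2 / 2 ^ i with hd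
    have hdpos : ∀ i, 0 < d i := fun i => by positivity
    have hdsum : ∀ n, ∑ i ∈ Finset.range n, d i ≤ δ := fun n => by
      rw [← tsum_geometric_two' δ]
      exact (summable_geometric_two' δ).sum_le_tsum _ fun i _ => (hdpos i).le
    set F : ℕ → LpJet p Ω := fun i => compJet (smoothContraction_softPos (hdpos i)) (U i) with hF
    have hFn : ∀ i, ‖F i‖ ≤ ‖U i‖ := fun i => norm_compJet_le hp _ _
    have hFs : Summable F := Summable.of_norm_bounded hsumm hFn
    have hFt : ∀ i, F i ∈ sobolevTilde p Ω := fun i => compJet_mem_sobolevTilde hΩ hp _ (hU i)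
    have hlim := hFs.hasSum.tendsto_sum_nat
    set G := ∑' i, F i with hG
    have hGt : G ∈ sobolevTilde p Ω := (isClosed_sobolevTilde p Ω).mem_of_tendsto hlim
      (Eventually.of_forall fun n => sum_mem_sobolevTilde hFt n)
    obtain ⟨ns, hns, hae⟩ := exists_subseq_ae_tendsto hlim
    have hGge : ∀ᵐ x ∂volume.restrict (O ∩ Ω), 1 - δ ≤ G none x := by
      have hFae : ∀ᵐ x ∂volume.restrict Ω, ∀ i, F i none x = softPos (d i) (U i none x) :=
        ae_all_iff.2 fun i => coeFn_compJet_none _ _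
      have hSae : ∀ᵐ x ∂volume.restrict Ω, ∀ n,
          (∑ i ∈ Finset.range n, F i) none x = ∑ i ∈ Finset.range n, F i none x :=
        ae_all_iff.2 fun n => coeFn_sum_none F n
      filter_upwards [h, ae_inter_of_ae hae, ae_inter_of_ae hFae, ae_inter_of_ae hSae]
        with x ⟨i, hi⟩ hx hFx hSx
      refine ge_of_tendsto hx ?_
      filter_upwards [eventually_gt_atTop i] with k hk
      have hik : i ∈ Finset.range (ns k) := Finset.mem_range.2 (hk.trans_le (hns.id_le k))
      -- A smoothed positive part may fall below 0 as far as the lower bound in use shows, but by at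
      -- most `d j`; after adding `d j` every term is nonnegative, and a single term bounds the sum
      -- from below.
      have hsingle := Finset.single_le_sum (f := fun j => F j none x + d j)
        (fun j _ => by
          have := max_sub_le_softPos (hdpos j) (U j none x)
          have := le_max_right (U j none x) 0
          simp only [hFx]; linarith) hik
      rw [Finset.sum_add_distrib] at hsingle
      have h1 := max_sub_le_softPos (hdpos i) (U i none x)
      have h2 := le_max_left (U i none x) 0
      have h3 := hdsum (ns k)
      rw [hSx]
      simp only [hFx] at hsingle ⊢
      linarith
    have hadm : (1 - δ)⁻¹ • G ∈ admissible p Ω O := by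
      refine ⟨smul_mem_sobolevTilde _ hGt, O, hO, subset_rfl, ?_⟩
      filter_upwards [hGge, ae_inter_of_ae (coeFn_smul_none (1 - δ)⁻¹ G)] with x h1 h2
      rw [h2, inv_mul_eq_div, le_div_iff₀ (by linarith)]
      linarith
    refine (capRoot_le_of_mem hadm).trans ?_
    rw [enorm_smul, Real.enorm_of_nonneg (inv_nonneg.2 (by linarith))]
    gcongr
    have h1 : ‖G‖ ≤ ∑' i, ‖U i‖ := tsum_of_norm_bounded hsumm.hasSum hFn
    rw [← ofReal_norm]
    refine (ENNReal.ofReal_le_ofReal h1).trans ?_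
    rw [ENNReal.ofReal_tsum_of_nonneg (fun _ => norm_nonneg _) hsumm]
    simp
  have hlim : Tendsto (fun δ : ℝ => ENNReal.ofReal (1 - δ)⁻¹ * ∑' i, ‖U i‖ₑ) (𝓝[>] 0)
      (𝓝 (∑' i, ‖U i‖ₑ)) := by
    have h1 : Tendsto (fun δ : ℝ => (1 - δ)⁻¹) (𝓝[>] 0) (𝓝 1) := by
      have : ContinuousAt (fun δ : ℝ => (1 - δ)⁻¹) 0 :=
        (continuousAt_const.sub continuousAt_id).inv₀ (by simp)
      simpa using this.tendsto.mono_left nhdsWithin_le_nhds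
    have := ENNReal.Tendsto.mul_const ((ENNReal.continuous_ofReal.tendsto 1).comp h1)
      (b := ∑' i, ‖U i‖ₑ) (Or.inr htop)
    simpa using this
  refine ge_of_tendsto hlim ?_
  filter_upwards [Ioo_mem_nhdsGT (zero_lt_one' ℝ)] with δ hδ using key δ hδ.1 hδ.2

theorem capRoot_le_add (hΩ : IsOpen Ω) (hp : p ≠ ∞) {U W : LpJet p Ω}
    (hU : U ∈ sobolevTilde p Ω) (hW : W ∈ sobolevTilde p Ω) {O : Set (Eucl N)} (hO : IsOpen O)
    (h : ∀ᵐ x ∂volume.restrict (O ∩ Ω), 1 ≤ U none x ∨ 1 ≤ W none x) :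
    capRoot p Ω O ≤ ‖U‖ₑ + ‖W‖ₑ := by
  set F : ℕ → LpJet p Ω := fun n => if n = 0 then U else if n = 1 then W else 0 with hF
  have hsum : ∑' i, ‖F i‖ₑ = ‖U‖ₑ + ‖W‖ₑ := by
    rw [tsum_eq_sum (s := Finset.range 2)]
    · simp [hF, Finset.sum_range_succ]
    · intro n hn
      have : 1 < n := by simpa using hn
      simp [hF, show n ≠ 0 by omega, show n ≠ 1 by omega]
  rw [← hsum]
  refine capRoot_le_tsum hΩ hp (fun i => ?_) hO ?_
  · simp only [hF]; split_ifs
    exacts [hU, hW, zero_mem_sobolevTilde]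
  · filter_upwards [h] with x hx
    rcases hx with hx | hx
    · exact ⟨0, by simpa [hF] using hx⟩
    · exact ⟨1, by simpa [hF] using hx⟩

/-- Near-optimal admissible functions with summable excess are chosen for the sets; on the union of
their neighbourhoods one of them is always at least 1. -/
theorem capRoot_iUnion_le (hΩ : IsOpen Ω) (hp : p ≠ ∞) (A : ℕ → Set (Eucl N)) :
    capRoot p Ω (⋃ i, A i) ≤ ∑' i, capRoot p Ω (A i) := by
  by_cases htop : ∑' i, capRoot p Ω (A i) = ∞
  · rw [htop]; exact le_top
  refine ENNReal.le_of_forall_pos_le_add fun ε hε _ => ?_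
  obtain ⟨d, hd, hdε⟩ := ENNReal.exists_pos_sum_of_countable (ENNReal.coe_ne_zero.2 hε.ne') ℕ
  have hex : ∀ i, ∃ U ∈ admissible p Ω (A i), ‖U‖ₑ < capRoot p Ω (A i) + d i := fun i =>
    exists_admissible_lt (ENNReal.lt_add_right (ENNReal.ne_top_of_tsum_ne_top htop i)
      (ENNReal.coe_ne_zero.2 (hd i).ne'))
  choose U hU hUlt using hex
  choose hUt V hV hAV hae using hU
  calc capRoot p Ω (⋃ i, A i) ≤ capRoot p Ω (⋃ i, V i) := capRoot_mono (iUnion_mono hAV)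
    _ ≤ ∑' i, ‖U i‖ₑ := by
        refine capRoot_le_tsum hΩ hp hUt (isOpen_iUnion hV) ?_
        rw [iUnion_inter, ae_restrict_iUnion_iff]
        intro i
        filter_upwards [hae i] with x hx using ⟨i, hx⟩
    _ ≤ ∑' i, (capRoot p Ω (A i) + d i) := ENNReal.tsum_le_tsum fun i => (hUlt i).le
    _ = _ := ENNReal.tsum_add
    _ ≤ _ := by gcongr

theorem capRoot_union_le (hΩ : IsOpen Ω) (hp : p ≠ ∞) (A B : Set (Eucl N)) :
    capRoot p Ω (A ∪ B) ≤ capRoot p Ω A + capRoot p Ω B := by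
  set F : ℕ → Set (Eucl N) := fun n => if n = 0 then A else if n = 1 then B else ∅ with hF
  have hsum : ∑' i, capRoot p Ω (F i) = capRoot p Ω A + capRoot p Ω B := by
    rw [tsum_eq_sum (s := Finset.range 2)]
    · simp [hF, Finset.sum_range_succ]
    · intro n hn
      have : 1 < n := by simpa using hn
      simp [hF, show n ≠ 0 by omega, show n ≠ 1 by omega, capRoot_empty]
  rw [← hsum]
  refine (capRoot_mono (union_subset ?_ ?_)).trans (capRoot_iUnion_le hΩ hp F)
  · exact subset_iUnion_of_subset 0 (by simp [hF])
  · exact subset_iUnion_of_subset 1 (by simp [hF])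

end RelativeCapacity
end

/-! ### Quasi continuity: from a.e. to q.e., Chebyshev, existence of versions. -/

noncomputable section

namespace RelativeCapacity

open Filter Topology

variable {N : ℕ} {p : ℝ≥0∞} {Ω : Set (Eucl N)} [hp1 : Fact (1 ≤ p)]

theorem qeOn_iff_capRoot (hp : p ≠ ∞) {S : Set (Eucl N)} {P : Eucl N → Prop} :
    QEOn p Ω S P ↔ capRoot p Ω {x ∈ S | ¬ P x} = 0 := relCap_eq_zero_iff hp

theorem QEOn.mono (hp : p ≠ ∞) {S S' : Set (Eucl N)} {P P' : Eucl N → Prop}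
    (h : QEOn p Ω S P) (hS : S' ⊆ S) (hP : ∀ x ∈ S', P x → P' x) : QEOn p Ω S' P' := by
  rw [qeOn_iff_capRoot hp] at h ⊢
  refine capRoot_eq_zero_of_subset (fun x hx => ?_) h
  exact ⟨hS hx.1, fun hc => hx.2 (hP x hx.1 hc)⟩

theorem QEOn.and (hΩ : IsOpen Ω) (hp : p ≠ ∞) {S : Set (Eucl N)} {P Q : Eucl N → Prop}
    (hP : QEOn p Ω S P) (hQ : QEOn p Ω S Q) : QEOn p Ω S (fun x => P x ∧ Q x) := by
  rw [qeOn_iff_capRoot hp] at hP hQ ⊢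
  have := capRoot_union_le hΩ hp {x ∈ S | ¬ P x} {x ∈ S | ¬ Q x}
  rw [hP, hQ, add_zero] at this
  refine capRoot_eq_zero_of_subset (fun x hx => ?_) (le_antisymm this zero_le)
  by_cases h : P x
  · exact Or.inr ⟨hx.1, fun hc => hx.2 ⟨h, hc⟩⟩
  · exact Or.inl ⟨hx.1, h⟩

theorem isQuasiCont_iff_capRoot (hp : p ≠ ∞) {u : Eucl N → ℝ} :
    IsQuasiCont p Ω u ↔ ∀ ε : ℝ≥0∞, 0 < ε → ∃ V, IsOpen V ∧ capRoot p Ω (V ∩ closure Ω) < ε ∧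
      ContinuousOn u (closure Ω \ V) := by
  have hpr := toReal_exponent_pos hp
  constructor
  · intro h ε hε
    obtain ⟨V, hV, hc, hu⟩ := h (ε ^ p.toReal) (ENNReal.rpow_pos_of_nonneg hε hpr.le)
    rw [relCap_eq_capRoot_rpow hp] at hc
    exact ⟨V, hV, (ENNReal.rpow_lt_rpow_iff hpr).1 hc, hu⟩
  · intro h ε hε
    obtain ⟨V, hV, hc, hu⟩ := h (ε ^ p.toReal⁻¹)
      (ENNReal.rpow_pos_of_nonneg hε (inv_pos.2 hpr).le)
    refine ⟨V, hV, ?_, hu⟩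
    rw [relCap_eq_capRoot_rpow hp]
    exact (ENNReal.lt_rpow_inv_iff hpr).1 hc

theorem isQuasiCont_of_continuousOn (hp : p ≠ ∞) {u : Eucl N → ℝ}
    (hu : ContinuousOn u (closure Ω)) : IsQuasiCont p Ω u := by
  rw [isQuasiCont_iff_capRoot hp]
  exact fun ε hε => ⟨∅, isOpen_empty, by simpa [capRoot_empty] using hε, by simpa using hu⟩

theorem IsQuasiCont.comp {u : Eucl N → ℝ} (hu : IsQuasiCont p Ω u) {T : ℝ → ℝ}
    (hT : Continuous T) : IsQuasiCont p Ω (fun x => T (u x)) := fun ε hε => by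
  obtain ⟨V, hV, hc, h⟩ := hu ε hε
  exact ⟨V, hV, hc, hT.comp_continuousOn h⟩

theorem IsQuasiCont.add (hΩ : IsOpen Ω) (hp : p ≠ ∞) {u v : Eucl N → ℝ}
    (hu : IsQuasiCont p Ω u) (hv : IsQuasiCont p Ω v) :
    IsQuasiCont p Ω (fun x => u x + v x) := by
  rw [isQuasiCont_iff_capRoot hp] at *
  intro ε hε
  have hε2 : 0 < ε / 2 := ENNReal.half_pos hε.ne'
  obtain ⟨V, hV, hc, h⟩ := hu _ hε2
  obtain ⟨W, hW, hc', h'⟩ := hv _ hε2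
  refine ⟨V ∪ W, hV.union hW, ?_, ?_⟩
  · rw [union_inter_distrib_right]
    refine (capRoot_union_le hΩ hp _ _).trans_lt ?_
    rw [← ENNReal.add_halves ε]
    exact ENNReal.add_lt_add hc hc'
  · exact (h.mono (sdiff_subset_sdiff_right subset_union_left)).add
      (h'.mono (sdiff_subset_sdiff_right subset_union_right))

theorem IsQuasiCont.sub (hΩ : IsOpen Ω) (hp : p ≠ ∞) {u v : Eucl N → ℝ}
    (hu : IsQuasiCont p Ω u) (hv : IsQuasiCont p Ω v) :
    IsQuasiCont p Ω (fun x => u x - v x) := by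
  simpa [sub_eq_add_neg] using hu.add hΩ hp (hv.comp (T := fun t => -t) continuous_neg)

/-- An inequality between a quasi continuous function and `0` that holds almost everywhere holds
quasi everywhere. -/
theorem IsQuasiCont.qeOn_nonneg_of_ae (hΩ : IsOpen Ω) (hp : p ≠ ∞) {u : Eucl N → ℝ} (hu : IsQuasiCont p Ω u)
    {V : Set (Eucl N)} (hV : IsOpen V) (h : ∀ᵐ x ∂volume.restrict (V ∩ Ω), 0 ≤ u x) :
    QEOn p Ω (V ∩ closure Ω) (fun x => 0 ≤ u x) := by
  rw [qeOn_iff_capRoot hp]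
  rw [isQuasiCont_iff_capRoot hp] at hu
  refine le_antisymm (le_of_forall_gt fun ε hε => ?_) zero_le
  obtain ⟨G, hG, hGε, hcont⟩ := hu ε hε
  obtain ⟨W, ⟨hW, V', hV', hGV', hae⟩, hWε⟩ := exists_admissible_lt hGε
  -- Off `G` the set where u < 0 is the trace of the open set `o`. Within `Ω`, the part of o ∩ V
  -- outside V' is therefore null, so `W`, admissible for the small set, is also admissible for the
  -- exceptional set.
  obtain ⟨o, ho, hoeq⟩ := continuousOn_iff'.1 hcont (Iio 0) isOpen_Iio
  refine (capRoot_le_of_mem (U := W) ⟨hW, (o ∩ V) ∪ V', (ho.inter hV).union hV', ?_, ?_⟩).trans_lt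
    hWε
  · rintro x ⟨⟨hxV, hxc⟩, hx⟩
    by_cases hxG : x ∈ G
    · exact Or.inr (hGV' ⟨hxG, hxc⟩)
    · have : x ∈ u ⁻¹' Iio 0 ∩ (closure Ω \ G) := ⟨not_le.1 hx, hxc, hxG⟩
      rw [hoeq] at this
      exact Or.inl ⟨this.1, hxV⟩
  · rw [ae_restrict_iff' (hV.inter hΩ).measurableSet] at h
    rw [ae_restrict_iff' (hV'.inter hΩ).measurableSet] at hae
    rw [ae_restrict_iff' (((ho.inter hV).union hV').inter hΩ).measurableSet]
    filter_upwards [h, hae] with x h1 h2 hx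
    by_cases hxV' : x ∈ V'
    · exact h2 ⟨hxV', hx.2⟩
    · have hxo := hx.1.resolve_right hxV'
      have hxc : x ∈ closure Ω := subset_closure hx.2
      have : x ∈ o ∩ (closure Ω \ G) := ⟨hxo.1, hxc, fun hxG => hxV' (hGV' ⟨hxG, hxc⟩)⟩
      rw [← hoeq] at this
      exact absurd (h1 ⟨hxo.2, hx.2⟩) (not_le.2 this.1)

theorem IsQuasiCont.qeOn_le_of_ae (hΩ : IsOpen Ω) (hp : p ≠ ∞) {u v : Eucl N → ℝ}
    (hu : IsQuasiCont p Ω u) (hv : IsQuasiCont p Ω v)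
    {V : Set (Eucl N)} (hV : IsOpen V) (h : ∀ᵐ x ∂volume.restrict (V ∩ Ω), u x ≤ v x) :
    QEOn p Ω (V ∩ closure Ω) (fun x => u x ≤ v x) :=
  ((hv.sub hΩ hp hu).qeOn_nonneg_of_ae hΩ hp hV (h.mono fun _ hx => sub_nonneg.2 hx)).mono hp
    subset_rfl fun _ _ hx => sub_nonneg.1 hx

theorem IsQuasiCont.qeOn_closure_le_of_ae (hΩ : IsOpen Ω) (hp : p ≠ ∞) {u v : Eucl N → ℝ}
    (hu : IsQuasiCont p Ω u) (hv : IsQuasiCont p Ω v)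
    (h : ∀ᵐ x ∂volume.restrict Ω, u x ≤ v x) :
    QEOn p Ω (closure Ω) (fun x => u x ≤ v x) := by
  have := hu.qeOn_le_of_ae hΩ hp hv isOpen_univ (by rwa [univ_inter])
  rwa [univ_inter] at this

/-- Shows that a Sobolev function has only one class of quasi continuous versions. -/
theorem IsQuasiCont.qeOn_closure_eq_of_ae (hΩ : IsOpen Ω) (hp : p ≠ ∞) {u v : Eucl N → ℝ}
    (hu : IsQuasiCont p Ω u) (hv : IsQuasiCont p Ω v)
    (h : ∀ᵐ x ∂volume.restrict Ω, u x = v x) :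
    QEOn p Ω (closure Ω) (fun x => u x = v x) :=
  ((hu.qeOn_closure_le_of_ae hΩ hp hv (h.mono fun _ hx => hx.le)).and hΩ hp
    (hv.qeOn_closure_le_of_ae hΩ hp hu (h.mono fun _ hx => hx.ge))).mono hp subset_rfl
    fun _ _ hx => le_antisymm hx.1 hx.2

/-- Off an open set of small capacity, u > 1 - ε holds on a relatively open set containing the
remaining points of `A`. The exceptional set is covered by the neighbourhood of a function `W` of
norm below ε; then U/(1 - ε) and `W` together bound the capacity, and ε → 0. -/
theorem capRoot_le_enorm_of_qeOn (hΩ : IsOpen Ω) (hp : p ≠ ∞) {U : LpJet p Ω}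
    (hU : U ∈ sobolevTilde p Ω) {u : Eucl N → ℝ} (hu : IsQuasiCont p Ω u)
    (hUu : U none =ᵐ[volume.restrict Ω] u) {A : Set (Eucl N)} (hA : A ⊆ closure Ω)
    (h : QEOn p Ω A (fun x => 1 ≤ u x)) : capRoot p Ω A ≤ ‖U‖ₑ := by
  have key : ∀ ε : ℝ, 0 < ε → ε < 1 →
      capRoot p Ω A ≤ ENNReal.ofReal (1 - ε)⁻¹ * ‖U‖ₑ + ENNReal.ofReal ε := by
    intro ε hε hε1
    rw [isQuasiCont_iff_capRoot hp] at hu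
    obtain ⟨G, hG, hGε, hcont⟩ := hu (ENNReal.ofReal ε) (ENNReal.ofReal_pos.2 hε)
    rw [qeOn_iff_capRoot hp] at h
    set E := {x ∈ A | ¬ 1 ≤ u x} with hE
    have hGE : capRoot p Ω (G ∩ closure Ω ∪ E) < ENNReal.ofReal ε := by
      refine (capRoot_union_le hΩ hp _ _).trans_lt ?_
      rwa [h, add_zero]
    obtain ⟨W, ⟨hW, V', hV', hGV', hae⟩, hWε⟩ := exists_admissible_lt hGE
    obtain ⟨o, ho, hoeq⟩ := continuousOn_iff'.1 hcont (Ioi (1 - ε)) isOpen_Ioi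
    have hsub : A ⊆ o ∪ V' := fun x hx => by
      by_cases hxV' : x ∈ V'
      · exact Or.inr hxV'
      · have hxG : x ∉ G := fun hc => hxV' (hGV' (Or.inl ⟨hc, hA hx⟩))
        have hxu : 1 ≤ u x := by
          by_contra hc
          exact hxV' (hGV' (Or.inr ⟨hx, hc⟩))
        have : x ∈ u ⁻¹' Ioi (1 - ε) ∩ (closure Ω \ G) :=
          ⟨show 1 - ε < u x by linarith, hA hx, hxG⟩
        rw [hoeq] at this
        exact Or.inl this.1
    have hle := capRoot_le_add hΩ hp (smul_mem_sobolevTilde (1 - ε)⁻¹ hU) hW (ho.union hV') (by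
      rw [ae_restrict_iff' (hV'.inter hΩ).measurableSet] at hae
      rw [ae_restrict_iff' ((ho.union hV').inter hΩ).measurableSet]
      have h1 := (ae_restrict_iff' hΩ.measurableSet).1 (coeFn_smul_none (1 - ε)⁻¹ U)
      have h2 := (ae_restrict_iff' hΩ.measurableSet).1 hUu
      filter_upwards [hae, h1, h2] with x h0 h1 h2 hx
      by_cases hxV' : x ∈ V'
      · exact Or.inr (h0 ⟨hxV', hx.2⟩)
      · have hxc : x ∈ closure Ω := subset_closure hx.2
        have : x ∈ o ∩ (closure Ω \ G) := ⟨hx.1.resolve_right hxV', hxc,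
          fun hxG => hxV' (hGV' (Or.inl ⟨hxG, hxc⟩))⟩
        rw [← hoeq] at this
        left
        rw [h1 hx.2, h2 hx.2, inv_mul_eq_div, le_div_iff₀ (by linarith), one_mul]
        exact (mem_Ioi.1 this.1).le)
    refine (capRoot_mono hsub).trans (hle.trans ?_)
    rw [enorm_smul, Real.enorm_of_nonneg (inv_nonneg.2 (by linarith))]
    gcongr
  have hlim : Tendsto (fun ε : ℝ => ENNReal.ofReal (1 - ε)⁻¹ * ‖U‖ₑ + ENNReal.ofReal ε) (𝓝[>] 0)
      (𝓝 (‖U‖ₑ)) := by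
    have h1 : Tendsto (fun δ : ℝ => (1 - δ)⁻¹) (𝓝[>] 0) (𝓝 1) := by
      have : ContinuousAt (fun δ : ℝ => (1 - δ)⁻¹) 0 :=
        (continuousAt_const.sub continuousAt_id).inv₀ (by simp)
      simpa using this.tendsto.mono_left nhdsWithin_le_nhds
    have h2 := ENNReal.Tendsto.mul_const ((ENNReal.continuous_ofReal.tendsto 1).comp h1)
      (b := ‖U‖ₑ) (Or.inr enorm_ne_top)
    have h3 : Tendsto (fun ε : ℝ => ENNReal.ofReal ε) (𝓝[>] 0) (𝓝 0) := by
      have := (ENNReal.continuous_ofReal.tendsto 0).mono_left (nhdsWithin_le_nhds (s := Ioi 0))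
      simpa using this
    simpa using h2.add h3
  refine ge_of_tendsto hlim ?_
  filter_upwards [Ioo_mem_nhdsGT (zero_lt_one' ℝ)] with δ hδ using key δ hδ.1 hδ.2

/-- The capacitary Chebyshev inequality. -/
theorem capRoot_setOf_le (hΩ : IsOpen Ω) (hp : p ≠ ∞) {U : LpJet p Ω}
    (hU : U ∈ sobolevTilde p Ω) {u : Eucl N → ℝ} (hu : IsQuasiCont p Ω u)
    (hUu : U none =ᵐ[volume.restrict Ω] u) {c : ℝ} (hc : 0 < c) :
    capRoot p Ω {x ∈ closure Ω | c ≤ u x} ≤ ENNReal.ofReal (‖U‖ / c) := by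
  have h := capRoot_le_enorm_of_qeOn hΩ hp (smul_mem_sobolevTilde c⁻¹ hU)
    (hu.comp (T := fun t => c⁻¹ * t) (by fun_prop)) (by
      filter_upwards [coeFn_smul_none c⁻¹ U, hUu] with x h1 h2
      rw [h1, h2]) (A := {x ∈ closure Ω | c ≤ u x}) (fun x hx => hx.1) (by
      rw [qeOn_iff_capRoot hp]
      convert capRoot_empty (p := p) (Ω := Ω)
      refine eq_empty_of_forall_notMem fun x hx => hx.2 ?_
      rw [inv_mul_eq_div, le_div_iff₀ hc, one_mul]
      exact hx.1.2)
  refine h.trans (le_of_eq ?_)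
  rw [← ofReal_norm, norm_smul, norm_inv, Real.norm_of_nonneg hc.le, inv_mul_eq_div]

theorem capRoot_setOf_le_abs (hΩ : IsOpen Ω) (hp : p ≠ ∞) {U : LpJet p Ω}
    (hU : U ∈ sobolevTilde p Ω) {u : Eucl N → ℝ} (hu : IsQuasiCont p Ω u)
    (hUu : U none =ᵐ[volume.restrict Ω] u) {c : ℝ} (hc : 0 < c) :
    capRoot p Ω {x ∈ closure Ω | c ≤ |u x|} ≤ ENNReal.ofReal (2 * ‖U‖ / c) := by
  have h1 := capRoot_setOf_le hΩ hp hU hu hUu hc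
  have h2 := capRoot_setOf_le hΩ hp (smul_mem_sobolevTilde (-1) hU)
    (hu.comp (T := fun t => -1 * t) (by fun_prop)) (by
      filter_upwards [coeFn_smul_none (-1) U, hUu] with x h1 h2
      rw [h1, h2]) hc
  have h3 := (capRoot_union_le hΩ hp _ _).trans (add_le_add h1 h2)
  refine (capRoot_mono fun x hx => ?_).trans (h3.trans (le_of_eq ?_))
  · rcases le_abs.1 hx.2 with h | h
    · exact Or.inl ⟨hx.1, h⟩
    · exact Or.inr ⟨hx.1, by simpa using h⟩
  · rw [← ENNReal.ofReal_add (by positivity) (by positivity), norm_smul]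
    congr 1
    simp
    ring

/-- Along a rapidly convergent sequence of continuous approximants, the Chebyshev inequality makes
the sets of large increments summable in capacity. Off a tail of them the convergence is uniform, so
the limit is continuous there. -/
theorem exists_isQuasiCont (hΩ : IsOpen Ω) (hp : p ≠ ∞) {U : LpJet p Ω}
    (hU : U ∈ sobolevTilde p Ω) :
    ∃ u, IsQuasiCont p Ω u ∧ U none =ᵐ[volume.restrict Ω] u := by
  have hU' := hU
  rw [sobolevTilde_eq_closure] at hU'
  obtain ⟨F₀, hF₀, hF₀U⟩ := mem_closure_iff_seq_limit.1 hU'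
  obtain ⟨ns, hns, hae₀⟩ := exists_subseq_ae_tendsto hF₀U
  have hsub := hF₀U.comp hns.tendsto_atTop
  -- The rate 4⁻ᵏ beats the level 2⁻ᵏ for the increments: Chebyshev leaves a bound of order 2⁻ᵏ,
  -- which is summable.
  obtain ⟨ms, hms, hrate⟩ := extraction_forall_of_eventually'
    (P := fun k n => dist (F₀ (ns n)) U < (1 / 4) ^ k)
    (fun k => (eventually_atTop.1 ((Metric.tendsto_nhds.1 hsub) ((1 / 4) ^ k) (by positivity))))
  set F : ℕ → LpJet p Ω := fun k => F₀ (ns (ms k)) with hF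
  have hFt : ∀ k, F k ∈ sobolevTilde p Ω := fun k => by
    rw [sobolevTilde_eq_closure]; exact subset_closure (hF₀ _)
  choose hFs f hf hFf using fun k => hF₀ (ns (ms k))
  have hae : ∀ᵐ x ∂volume.restrict Ω, Tendsto (fun k => f k x) atTop (𝓝 (U none x)) := by
    filter_upwards [hae₀, ae_all_iff.2 hFf] with x h1 h2
    refine (h1.comp hms.tendsto_atTop).congr fun k => ?_
    exact h2 k
  set u : Eucl N → ℝ := fun x => limUnder atTop fun k => f k x with hu
  refine ⟨u, ?_, by filter_upwards [hae] with x hx using hx.limUnder_eq.symm⟩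
  set D : ℕ → Set (Eucl N) := fun k => {x ∈ closure Ω | 1 / 2 ^ k ≤ |f (k + 1) x - f k x|} with hD
  have hcontd : ∀ k, ContinuousOn (fun x => f (k + 1) x - f k x) (closure Ω) := fun k =>
    (hf (k + 1)).1.sub (hf k).1
  have hDcap : ∀ k, capRoot p Ω (D k) ≤ ENNReal.ofReal (4 / 2 ^ k) := fun k => by
    have hdist : ‖F (k + 1) - F k‖ ≤ 2 * (1 / 4) ^ k := by
      rw [← dist_eq_norm]
      refine (dist_triangle_right _ _ U).trans ?_
      have h1 := (hrate (k + 1)).le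
      have h2 := (hrate k).le
      have h3 : (1 / 4 : ℝ) ^ (k + 1) ≤ (1 / 4) ^ k :=
        pow_le_pow_of_le_one (by norm_num) (by norm_num) k.le_succ
      simp only [hF]; linarith
    refine (capRoot_setOf_le_abs hΩ hp (sub_mem_sobolevTilde (hFt (k + 1)) (hFt k))
      (isQuasiCont_of_continuousOn hp (hcontd k)) ?_ (by positivity)).trans
      (ENNReal.ofReal_le_ofReal ?_)
    · filter_upwards [coeFn_sub_none (F (k + 1)) (F k), hFf k, hFf (k + 1)] with x h1 h2 h3
      rw [h1, ← h2, ← h3]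
    · calc 2 * ‖F (k + 1) - F k‖ / (1 / 2 ^ k) ≤ 2 * (2 * (1 / 4) ^ k) / (1 / 2 ^ k) := by gcongr
        _ = 4 / 2 ^ k := by
          have : (4 : ℝ) ^ k = 2 ^ k * 2 ^ k := by rw [← mul_pow]; norm_num
          rw [one_div_pow, this]
          field_simp
          norm_num
  -- The strict inequality gives relatively open sets contained in the sets `D k`, whose capacities
  -- are under control.
  choose o ho hoeq using fun k => continuousOn_iff'.1 ((hcontd k).abs) (Ioi (1 / 2 ^ k)) isOpen_Ioi
  rw [isQuasiCont_iff_capRoot hp]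
  intro ε hε
  have htail : ∀ m : ℕ, capRoot p Ω ((⋃ k, o (m + k)) ∩ closure Ω) ≤ ENNReal.ofReal (8 / 2 ^ m) := by
    intro m
    calc capRoot p Ω ((⋃ k, o (m + k)) ∩ closure Ω) ≤ capRoot p Ω (⋃ k, D (m + k)) := by
          refine capRoot_mono ?_
          rw [iUnion_inter]
          refine iUnion_mono fun k x hx => ?_
          rw [← hoeq] at hx
          exact ⟨hx.2, (mem_Ioi.1 hx.1).le⟩
      _ ≤ ∑' k, capRoot p Ω (D (m + k)) := capRoot_iUnion_le hΩ hp _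
      -- Here 8/2ᵐ/2/2ᵏ is 4/2ᵐ⁺ᵏ, written in the shape whose sum over k is 8/2ᵐ.
      _ ≤ ∑' k : ℕ, ENNReal.ofReal (8 / 2 ^ m / 2 / 2 ^ k) := by
          refine ENNReal.tsum_le_tsum fun k => (hDcap _).trans (ENNReal.ofReal_le_ofReal ?_)
          rw [pow_add]
          apply le_of_eq
          field_simp
          norm_num
      _ = _ := by
          rw [← ENNReal.ofReal_tsum_of_nonneg (fun k => by positivity) (summable_geometric_two' _),
            tsum_geometric_two']
  have hzero : Tendsto (fun m : ℕ => ENNReal.ofReal (8 / 2 ^ m)) atTop (𝓝 0) := by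
    have h1 : Tendsto (fun m : ℕ => (8 : ℝ) / 2 ^ m) atTop (𝓝 0) :=
      tendsto_const_nhds.div_atTop (tendsto_pow_atTop_atTop_of_one_lt one_lt_two)
    have := (ENNReal.continuous_ofReal.tendsto 0).comp h1
    rwa [ENNReal.ofReal_zero] at this
  obtain ⟨m, hm⟩ := ((tendsto_order.1 hzero).2 ε hε).exists
  refine ⟨⋃ k, o (m + k), isOpen_iUnion fun k => ho _, (htail m).trans_lt hm, ?_⟩
  set S := closure Ω \ ⋃ k, o (m + k) with hS
  have hstep : ∀ x ∈ S, ∀ k, dist (f (m + k) x) (f (m + (k + 1)) x) ≤ 2 / 2 ^ m / 2 / 2 ^ k := by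
    intro x hx k
    have hnot : x ∉ o (m + k) := fun hc => hx.2 (mem_iUnion.2 ⟨k, hc⟩)
    have h1 : |f (m + k + 1) x - f (m + k) x| ≤ 1 / 2 ^ (m + k) := by
      by_contra hc
      have : x ∈ (fun x => |f (m + k + 1) x - f (m + k) x|) ⁻¹' Ioi (1 / 2 ^ (m + k)) ∩
        closure Ω := ⟨not_le.1 hc, hx.1⟩
      rw [hoeq] at this
      exact hnot this.1
    rw [dist_comm, Real.dist_eq, ← add_assoc]
    refine h1.trans (le_of_eq ?_)
    rw [pow_add]
    field_simp
  have hlim : ∀ x ∈ S, Tendsto (fun k => f (m + k) x) atTop (𝓝 (u x)) := by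
    intro x hx
    have hc : CauchySeq fun k => f (m + k) x := cauchySeq_of_le_geometric_two (hstep x hx)
    obtain ⟨a, ha⟩ := cauchySeq_tendsto_of_complete hc
    have ha' : Tendsto (fun k => f k x) atTop (𝓝 a) := by
      rw [← tendsto_add_atTop_iff_nat m]
      simpa only [add_comm] using ha
    rw [show u x = a from ha'.limUnder_eq]
    exact ha
  have hunif : TendstoUniformlyOn (fun k => f (m + k)) u atTop S := by
    rw [Metric.tendstoUniformlyOn_iff]
    intro η hη
    have h1 : Tendsto (fun k : ℕ => (2 : ℝ) / 2 ^ m / 2 ^ k) atTop (𝓝 0) :=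
      tendsto_const_nhds.div_atTop (tendsto_pow_atTop_atTop_of_one_lt one_lt_two)
    filter_upwards [(tendsto_order.1 h1).2 η hη] with k hk x hx
    rw [dist_comm]
    exact (dist_le_of_le_geometric_two_of_tendsto (hstep x hx) (hlim x hx) k).trans_lt hk
  exact hunif.continuousOn (Frequently.of_forall fun k => (hf (m + k)).1.mono sdiff_subset)

end RelativeCapacity
end

/-! ### Uniform convexity of the Sobolev norm. -/

noncomputable section

namespace RelativeCapacity

open Filter Topology

/-- The defect of convexity of `t ↦ |t| ^ q` at the midpoint of `a` and `b`. -/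
def midGap (q a b : ℝ) : ℝ := (|a| ^ q + |b| ^ q) / 2 - |(a + b) / 2| ^ q

theorem midGap_pos {q : ℝ} (hq : 1 < q) {a b : ℝ} (hab : a ≠ b) : 0 < midGap q a b := by
  have hq0 : 0 < q := by linarith
  rw [midGap, sub_pos]
  by_cases h : |a| = |b|
  -- Strict convexity on [0, ∞) does not see a change of sign, but in that case the midpoint is 0
  -- and the gap is |b|^q.
  · have hab' : a = -b := (abs_eq_abs.1 h).resolve_left hab
    have hb : b ≠ 0 := fun hb => hab (by rw [hab', hb, neg_zero])
    have : 0 < |b| ^ q := Real.rpow_pos_of_pos (abs_pos.2 hb) q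
    rw [h, hab']
    simp [Real.zero_rpow hq0.ne', this]
  · have h1 := (strictConvexOn_rpow hq).2 (abs_nonneg a) (abs_nonneg b) h
      (by norm_num : (0 : ℝ) < 1 / 2) (by norm_num : (0 : ℝ) < 1 / 2) (by norm_num)
    simp only [smul_eq_mul] at h1
    have h2 : |(a + b) / 2| ^ q ≤ (1 / 2 * |a| + 1 / 2 * |b|) ^ q := by
      refine Real.rpow_le_rpow (abs_nonneg _) ?_ hq0.le
      rw [abs_div, abs_two]
      linarith [abs_add_le a b]
    linarith

theorem midGap_nonneg {q : ℝ} (hq : 1 < q) (a b : ℝ) : 0 ≤ midGap q a b := by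
  by_cases h : a = b
  · rw [midGap, h]; simp
  · exact (midGap_pos hq h).le

/-- All terms are homogeneous of degree q, so the unit sphere suffices. Where the ε-term fails to
dominate strictly, a ≠ b, so by compactness the gap is bounded below by some δ > 0, while |a - b|^q
≤ 2^q; hence C = 2^q/δ. -/
theorem exists_abs_sub_rpow_le {q : ℝ} (hq : 1 < q) {ε : ℝ} (hε : 0 < ε) :
    ∃ C, 0 ≤ C ∧ ∀ a b : ℝ, |a - b| ^ q ≤ ε * (|a| ^ q + |b| ^ q) + C * midGap q a b := by
  have hq0 : 0 < q := by linarith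
  have hrp : ∀ {f : ℝ × ℝ → ℝ}, Continuous f → Continuous fun z => |f z| ^ q := fun hf =>
    hf.abs.rpow_const fun _ => Or.inr hq0.le
  have hc1 : Continuous fun z : ℝ × ℝ => |z.1 - z.2| ^ q := hrp (by fun_prop)
  have hc2 : Continuous fun z : ℝ × ℝ => ε * (|z.1| ^ q + |z.2| ^ q) :=
    continuous_const.mul ((hrp continuous_fst).add (hrp continuous_snd))
  have hc3 : Continuous fun z : ℝ × ℝ => midGap q z.1 z.2 :=
    (((hrp continuous_fst).add (hrp continuous_snd)).div_const 2).sub (hrp (by fun_prop))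
  set K := Metric.sphere (0 : ℝ × ℝ) 1 ∩
    {z | ε * (|z.1| ^ q + |z.2| ^ q) ≤ |z.1 - z.2| ^ q} with hK
  have hKc : IsCompact K := (isCompact_sphere _ _).inter_right (isClosed_le hc2 hc1)
  have hpos : ∀ z ∈ K, 0 < midGap q z.1 z.2 := by
    rintro ⟨a, b⟩ ⟨hz, hz'⟩
    refine midGap_pos hq fun hab => ?_
    simp only at hab
    subst hab
    have ha : a ≠ 0 := by
      rintro rfl
      simp at hz
    have : 0 < |a| ^ q := Real.rpow_pos_of_pos (abs_pos.2 ha) q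
    simp only [mem_ofPred_eq, sub_self, abs_zero, Real.zero_rpow hq0.ne'] at hz'
    nlinarith
  obtain ⟨δ, hδ, hδK⟩ := hKc.exists_forall_le' hc3.continuousOn hpos
  refine ⟨2 ^ q / δ, by positivity, fun a b => ?_⟩
  have hsphere : ∀ z ∈ Metric.sphere (0 : ℝ × ℝ) 1,
      |z.1 - z.2| ^ q ≤ ε * (|z.1| ^ q + |z.2| ^ q) + 2 ^ q / δ * midGap q z.1 z.2 := by
    intro z hz
    by_cases hzK : z ∈ K
    · have h1 : |z.1 - z.2| ^ q ≤ 2 ^ q := by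
        refine Real.rpow_le_rpow (abs_nonneg _) ?_ hq0.le
        have hn : ‖z‖ = 1 := by simpa using hz
        have h1 : |z.1| ≤ 1 := hn ▸ norm_fst_le z
        have h2 : |z.2| ≤ 1 := hn ▸ norm_snd_le z
        linarith [abs_sub z.1 z.2]
      have h2 : 2 ^ q ≤ 2 ^ q / δ * midGap q z.1 z.2 := by
        rw [div_mul_eq_mul_div, le_div_iff₀ hδ]
        exact mul_le_mul_of_nonneg_left (hδK z hzK) (by positivity)
      have h3 : 0 ≤ ε * (|z.1| ^ q + |z.2| ^ q) := by positivity
      linarith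
    · have h1 : |z.1 - z.2| ^ q < ε * (|z.1| ^ q + |z.2| ^ q) := by
        by_contra hc
        exact hzK ⟨hz, not_lt.1 hc⟩
      have h2 : 0 ≤ 2 ^ q / δ * midGap q z.1 z.2 :=
        mul_nonneg (by positivity) (midGap_nonneg hq _ _)
      linarith
  by_cases h0 : (a, b) = (0 : ℝ × ℝ)
  · obtain ⟨rfl, rfl⟩ := Prod.mk_eq_zero.1 h0
    simp [midGap, Real.zero_rpow hq0.ne']
  · set s := ‖(a, b)‖ with hs
    have hspos : 0 < s := norm_pos_iff.2 h0
    have hz : s⁻¹ • (a, b) ∈ Metric.sphere (0 : ℝ × ℝ) 1 := by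
      rw [mem_sphere_zero_iff_norm, norm_smul, norm_inv, Real.norm_of_nonneg hspos.le, ← hs]
      exact inv_mul_cancel₀ hspos.ne'
    have hscale : ∀ t : ℝ, |s⁻¹ * t| ^ q = (s ^ q)⁻¹ * |t| ^ q := fun t => by
      rw [abs_mul, abs_of_pos (inv_pos.2 hspos), Real.mul_rpow (inv_pos.2 hspos).le (abs_nonneg _),
        Real.inv_rpow hspos.le]
    have h := hsphere _ hz
    simp only [Prod.smul_mk, smul_eq_mul, midGap] at h
    rw [← mul_sub, ← mul_add, mul_div_assoc, hscale, hscale, hscale, hscale] at h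
    have hsq : 0 < s ^ q := Real.rpow_pos_of_pos hspos q
    have h' : (s ^ q)⁻¹ * |a - b| ^ q ≤
        (s ^ q)⁻¹ * (ε * (|a| ^ q + |b| ^ q) + 2 ^ q / δ * midGap q a b) := by
      refine h.trans (le_of_eq ?_)
      rw [midGap]; ring
    exact le_of_mul_le_mul_left h' (inv_pos.2 hsq)

section Lp

variable {α : Type*} [MeasurableSpace α] {μ : Measure α} {p : ℝ≥0∞}

theorem norm_rpow_eq_integral (hp0 : p ≠ 0) (hp : p ≠ ∞) (f : Lp ℝ p μ) :
    ‖f‖ ^ p.toReal = ∫ x, |f x| ^ p.toReal ∂μ := by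
  have hpr : 0 < p.toReal := ENNReal.toReal_pos hp0 hp
  have hnn : 0 ≤ ∫ x, |f x| ^ p.toReal ∂μ := integral_nonneg fun x => by positivity
  rw [Lp.norm_def, (Lp.memLp f).eLpNorm_eq_integral_rpow_norm hp0 hp, ENNReal.toReal_ofReal
    (by simp only [Real.norm_eq_abs]; positivity)]
  simp only [Real.norm_eq_abs]
  rw [← Real.rpow_mul hnn, inv_mul_cancel₀ hpr.ne', Real.rpow_one]

/-- The scalar inequality integrates termwise. Summed over the function and its derivatives, it
gives the same inequality for the Sobolev norm. -/
theorem norm_sub_rpow_le [Fact (1 ≤ p)] (hp : p ≠ ∞) {ε C : ℝ}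
    (h : ∀ a b : ℝ, |a - b| ^ p.toReal ≤
      ε * (|a| ^ p.toReal + |b| ^ p.toReal) + C * midGap p.toReal a b) (f g : Lp ℝ p μ) :
    ‖f - g‖ ^ p.toReal ≤ ε * (‖f‖ ^ p.toReal + ‖g‖ ^ p.toReal) +
      C * ((‖f‖ ^ p.toReal + ‖g‖ ^ p.toReal) / 2 - ‖(2⁻¹ : ℝ) • (f + g)‖ ^ p.toReal) := by
  have hp0 : p ≠ 0 := (zero_lt_one.trans_le Fact.out).ne'
  have hi : ∀ k : Lp ℝ p μ, Integrable (fun x => |k x| ^ p.toReal) μ := fun k =>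
    (Lp.memLp k).integrable_norm_rpow hp0 hp
  simp only [norm_rpow_eq_integral hp0 hp]
  have hfg : Integrable (fun x => |f x| ^ p.toReal + |g x| ^ p.toReal) μ := (hi f).add (hi g)
  have hgap : Integrable (fun x => (|f x| ^ p.toReal + |g x| ^ p.toReal) / 2 -
      |((2⁻¹ : ℝ) • (f + g) : Lp ℝ p μ) x| ^ p.toReal) μ := (hfg.div_const 2).sub (hi _)
  rw [← integral_add (hi f) (hi g), ← integral_const_mul, ← integral_div,
    ← integral_sub (hfg.div_const 2) (hi _), ← integral_const_mul,
    ← integral_add (hfg.const_mul ε) (hgap.const_mul C)]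
  refine integral_mono_ae (hi _)
    ((hfg.const_mul ε).add (hgap.const_mul C)) ?_
  filter_upwards [Lp.coeFn_sub f g, Lp.coeFn_smul (2⁻¹ : ℝ) (f + g), Lp.coeFn_add f g]
    with x h1 h2 h3
  rw [h1, h2, Pi.smul_apply, h3]
  have := h (f x) (g x)
  rw [midGap, div_eq_inv_mul (f x + g x)] at this
  exact this

end Lp

variable {N : ℕ} {p : ℝ≥0∞} {Ω : Set (Eucl N)} [hp1 : Fact (1 ≤ p)]

theorem jet_norm_rpow (hp : p ≠ ∞) (U : LpJet p Ω) :
    ‖U‖ ^ p.toReal = ∑ j, ‖U j‖ ^ p.toReal := by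
  have hpr := toReal_exponent_pos hp
  rw [PiLp.norm_eq_sum hpr, ← Real.rpow_mul (Finset.sum_nonneg fun j _ => by positivity),
    one_div_mul_cancel hpr.ne', Real.rpow_one]

/-- Uniform convexity of the Sobolev norm: in a midpoint convex set whose elements have norm at
least `m`, elements with norm close to `m` are close to each other. -/
theorem exists_forall_norm_sub_lt (hp1' : 1 < p) (hp : p ≠ ∞) {K : Set (LpJet p Ω)}
    (hK : ∀ U ∈ K, ∀ V ∈ K, (2⁻¹ : ℝ) • (U + V) ∈ K) {m : ℝ} (hm0 : 0 ≤ m)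
    (hm : ∀ U ∈ K, m ≤ ‖U‖) {η : ℝ} (hη : 0 < η) :
    ∃ δ > 0, ∀ U ∈ K, ∀ V ∈ K, ‖U‖ < m + δ → ‖V‖ < m + δ → ‖U - V‖ < η := by
  set q := p.toReal with hq
  have hq0 : 0 < q := toReal_exponent_pos hp
  have hq1 : 1 < q := by
    have := (ENNReal.toReal_lt_toReal ENNReal.one_ne_top hp).2 hp1'
    simpa using this
  have hηq : 0 < η ^ q := Real.rpow_pos_of_pos hη q
  have hm1 : 0 < (m + 1) ^ q := Real.rpow_pos_of_pos (by linarith) q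
  -- Both norms will be below m + 1, so this ε makes the first term at most η^q/2; `δ` is then
  -- chosen so that the gap term is less than η^q/2.
  obtain ⟨C, hC0, hC⟩ := exists_abs_sub_rpow_le hq1 (ε := η ^ q / (4 * (m + 1) ^ q))
    (by positivity)
  set ε := η ^ q / (4 * (m + 1) ^ q) with hε
  have hcont : Tendsto (fun δ : ℝ => C * ((m + δ) ^ q - m ^ q)) (𝓝[>] 0) (𝓝 0) := by
    have : Continuous fun δ : ℝ => C * ((m + δ) ^ q - m ^ q) :=
      continuous_const.mul (((continuous_const.add continuous_id).rpow_const
        fun _ => Or.inr hq0.le).sub continuous_const)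
    simpa using (this.tendsto 0).mono_left (nhdsWithin_le_nhds (s := Ioi 0))
  obtain ⟨δ, hδ1, hδ⟩ := (((tendsto_order.1 hcont).2 (η ^ q / 2) (by positivity)).and
    (Ioo_mem_nhdsGT (zero_lt_one' ℝ))).exists
  refine ⟨δ, hδ.1, fun U hU V hV hUm hVm => ?_⟩
  have key : ‖U - V‖ ^ q ≤ ε * (‖U‖ ^ q + ‖V‖ ^ q) +
      C * ((‖U‖ ^ q + ‖V‖ ^ q) / 2 - ‖(2⁻¹ : ℝ) • (U + V)‖ ^ q) := by
    simp only [hq, jet_norm_rpow hp]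
    rw [← Finset.sum_add_distrib, Finset.mul_sum, Finset.sum_div, ← Finset.sum_sub_distrib,
      Finset.mul_sum, ← Finset.sum_add_distrib]
    exact Finset.sum_le_sum fun j _ => norm_sub_rpow_le hp hC (U j) (V j)
  have h1 : m ^ q ≤ ‖(2⁻¹ : ℝ) • (U + V)‖ ^ q :=
    Real.rpow_le_rpow hm0 (hm _ (hK U hU V hV)) hq0.le
  have h2 : ‖U‖ ^ q ≤ (m + δ) ^ q := Real.rpow_le_rpow (norm_nonneg _) hUm.le hq0.le
  have h3 : ‖V‖ ^ q ≤ (m + δ) ^ q := Real.rpow_le_rpow (norm_nonneg _) hVm.le hq0.le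
  have h4 : (m + δ) ^ q ≤ (m + 1) ^ q :=
    Real.rpow_le_rpow (by linarith [hδ.1]) (by linarith [hδ.2]) hq0.le
  have h5 : ε * (‖U‖ ^ q + ‖V‖ ^ q) ≤ η ^ q / 2 := by
    calc ε * (‖U‖ ^ q + ‖V‖ ^ q) ≤ ε * (2 * (m + 1) ^ q) := by
          refine mul_le_mul_of_nonneg_left (by linarith) (by positivity)
      _ = η ^ q / 2 := by rw [hε]; field_simp; norm_num
  have h6 : C * ((‖U‖ ^ q + ‖V‖ ^ q) / 2 - ‖(2⁻¹ : ℝ) • (U + V)‖ ^ q) ≤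
      C * ((m + δ) ^ q - m ^ q) := mul_le_mul_of_nonneg_left (by linarith) hC0
  have : ‖U - V‖ ^ q < η ^ q := by linarith
  exact (Real.rpow_lt_rpow_iff (norm_nonneg _) hη.le hq0).1 this

end RelativeCapacity
end

/-! ### The closed convex set of candidates and its minimizer. -/

noncomputable section

namespace RelativeCapacity

open Filter Topology

variable {N : ℕ} {p : ℝ≥0∞} {Ω : Set (Eucl N)} [hp1 : Fact (1 ≤ p)]

variable (p Ω) in
/-- The functions in `W̃^{1,p}(Ω)` that have a quasi continuous version which is `≥ 1` quasi
everywhere on `A`. -/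
def candidates (A : Set (Eucl N)) : Set (LpJet p Ω) :=
  {U | U ∈ sobolevTilde p Ω ∧ ∃ u, IsQuasiCont p Ω u ∧ U none =ᵐ[volume.restrict Ω] u ∧
    QEOn p Ω A (fun x => 1 ≤ u x)}

variable {A : Set (Eucl N)}

theorem admissible_subset_candidates (hΩ : IsOpen Ω) (hp : p ≠ ∞) (hA : A ⊆ closure Ω) :
    admissible p Ω A ⊆ candidates p Ω A := by
  rintro U ⟨hU, V, hV, hAV, hae⟩
  obtain ⟨u, hu, hUu⟩ := exists_isQuasiCont hΩ hp hU
  refine ⟨hU, u, hu, hUu, ?_⟩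
  have hae' : ∀ᵐ x ∂volume.restrict (V ∩ Ω), 1 ≤ u x := by
    filter_upwards [hae, ae_inter_of_ae hUu] with x h1 h2
    rwa [← h2]
  exact ((isQuasiCont_of_continuousOn hp continuousOn_const).qeOn_le_of_ae hΩ hp hu hV
    hae').mono hp (fun x hx => ⟨hAV hx, hA hx⟩) fun _ _ h => h

theorem capRoot_le_of_mem_candidates (hΩ : IsOpen Ω) (hp : p ≠ ∞) (hA : A ⊆ closure Ω)
    {U : LpJet p Ω} (hU : U ∈ candidates p Ω A) : capRoot p Ω A ≤ ‖U‖ₑ := by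
  obtain ⟨hU, u, hu, hUu, h⟩ := hU
  exact capRoot_le_enorm_of_qeOn hΩ hp hU hu hUu hA h

theorem midpoint_mem_candidates (hΩ : IsOpen Ω) (hp : p ≠ ∞) {U V : LpJet p Ω}
    (hU : U ∈ candidates p Ω A) (hV : V ∈ candidates p Ω A) :
    (2⁻¹ : ℝ) • (U + V) ∈ candidates p Ω A := by
  obtain ⟨hU, u, hu, hUu, hu1⟩ := hU
  obtain ⟨hV, v, hv, hVv, hv1⟩ := hV
  refine ⟨smul_mem_sobolevTilde _ (add_mem_sobolevTilde hU hV), fun x => 2⁻¹ * (u x + v x),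
    (hu.add hΩ hp hv).comp (T := fun t => 2⁻¹ * t) (by fun_prop), ?_,
    (hu1.and hΩ hp hv1).mono hp subset_rfl fun x _ hx => by linarith [hx.1, hx.2]⟩
  filter_upwards [coeFn_smul_none 2⁻¹ (U + V), coeFn_add_none U V, hUu, hVv] with x h1 h2 h3 h4
  rw [h1, h2, h3, h4]

/-- By monotonicity T(u) ≥ T(1) where u ≥ 1, and division by T(1) restores the constraint. -/
theorem smul_compJet_mem_candidates (hΩ : IsOpen Ω) (hp : p ≠ ∞) {T T' : ℝ → ℝ}
    (hT : SmoothContraction T T') (hT1 : 0 < T 1) {U : LpJet p Ω}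
    (hU : U ∈ candidates p Ω A) : (T 1)⁻¹ • compJet hT U ∈ candidates p Ω A := by
  obtain ⟨hU, u, hu, hUu, hu1⟩ := hU
  refine ⟨smul_mem_sobolevTilde _ (compJet_mem_sobolevTilde hΩ hp hT hU),
    fun x => (T 1)⁻¹ * T (u x),
    hu.comp (T := fun t => (T 1)⁻¹ * T t) (continuous_const.mul hT.continuous), ?_,
    hu1.mono hp subset_rfl fun x _ hx => ?_⟩
  · filter_upwards [coeFn_smul_none (T 1)⁻¹ (compJet hT U), coeFn_compJet_none hT U, hUu]
      with x h1 h2 h3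
    rw [h1, h2, h3]
  · beta_reduce
    rw [inv_mul_eq_div, le_div_iff₀ hT1, one_mul]
    exact hT.monotone hx

/-- Where v ≤ 1 - 1/(k+1) and uₙ ≥ 1, the difference uₙ - v is at least 1/(k+1). By Chebyshev the
capacity of that set tends to 0 with the norm of uₙ - v, and the levels k are combined by
subadditivity. -/
theorem isClosed_candidates (hΩ : IsOpen Ω) (hp : p ≠ ∞) (hA : A ⊆ closure Ω) :
    IsClosed (candidates p Ω A) := by
  refine IsSeqClosed.isClosed fun U V hU hUV => ?_
  have hV : V ∈ sobolevTilde p Ω := (isClosed_sobolevTilde p Ω).mem_of_tendsto hUV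
    (Eventually.of_forall fun n => (hU n).1)
  obtain ⟨v, hv, hVv⟩ := exists_isQuasiCont hΩ hp hV
  refine ⟨hV, v, hv, hVv, ?_⟩
  choose hUt u hu hUu hu1 using hU
  rw [qeOn_iff_capRoot hp]
  have hlev : ∀ k : ℕ, capRoot p Ω {x ∈ A | 1 / (k + 1 : ℝ) ≤ 1 - v x} = 0 := by
    intro k
    have hk : (0 : ℝ) < 1 / (k + 1) := by positivity
    have hlim : Tendsto (fun n => ENNReal.ofReal (‖U n - V‖ / (1 / (k + 1 : ℝ)))) atTop (𝓝 0) := by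
      have h1 := (tendsto_iff_norm_sub_tendsto_zero.1 hUV).div_const (1 / (k + 1 : ℝ))
      rw [zero_div] at h1
      have := (ENNReal.continuous_ofReal.tendsto 0).comp h1
      rwa [ENNReal.ofReal_zero] at this
    refine le_antisymm (ge_of_tendsto' hlim fun n => ?_) zero_le
    have h1 := capRoot_setOf_le hΩ hp (sub_mem_sobolevTilde (hUt n) hV) ((hu n).sub hΩ hp hv)
      (by filter_upwards [coeFn_sub_none (U n) V, hUu n, hVv] with x h1 h2 h3; rw [h1, h2, h3]) hk
    have h2 := (capRoot_union_le hΩ hp {x ∈ A | ¬ 1 ≤ u n x} _).trans (add_le_add_right h1 _)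
    rw [(qeOn_iff_capRoot hp).1 (hu1 n), zero_add] at h2
    refine (capRoot_mono fun x hx => ?_).trans h2
    by_cases hux : 1 ≤ u n x
    · exact Or.inr ⟨hA hx.1, hx.2.trans (by linarith)⟩
    · exact Or.inl ⟨hx.1, hux⟩
  have hun := capRoot_iUnion_le hΩ hp fun k : ℕ => {x ∈ A | 1 / (k + 1 : ℝ) ≤ 1 - v x}
  simp only [hlev, tsum_zero] at hun
  refine capRoot_eq_zero_of_subset (fun x hx => ?_) (le_antisymm hun zero_le)
  obtain ⟨k, hk⟩ := exists_nat_one_div_lt (sub_pos.2 (not_le.1 hx.2))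
  exact mem_iUnion.2 ⟨k, hx.1, hk.le⟩

/-- A candidate of minimal norm is invariant under pointwise limits of smooth contractions that
fix `1`. -/
theorem ae_eq_of_tendsto_smoothContraction (hΩ : IsOpen Ω) (hp1' : 1 < p) (hp : p ≠ ∞)
    {U : LpJet p Ω} (hU : U ∈ candidates p Ω A) (hmin : ∀ V ∈ candidates p Ω A, ‖U‖ ≤ ‖V‖)
    {T T' : ℕ → ℝ → ℝ} (hT : ∀ n, SmoothContraction (T n) (T' n)) (hT1 : ∀ n, 0 < T n 1)
    {τ : ℝ → ℝ} (hτ1 : τ 1 = 1) (hτ : ∀ t, Tendsto (fun n => T n t) atTop (𝓝 (τ t))) :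
    ∀ᵐ x ∂volume.restrict Ω, τ (U none x) = U none x := by
  set W : ℕ → LpJet p Ω := fun n => (T n 1)⁻¹ • compJet (hT n) U with hW
  have hWK : ∀ n, W n ∈ candidates p Ω A := fun n =>
    smul_compJet_mem_candidates hΩ hp (hT n) (hT1 n) hU
  have hinv : Tendsto (fun n => (T n 1)⁻¹) atTop (𝓝 1) := by
    have := (hτ 1).inv₀ (by rw [hτ1]; exact one_ne_zero)
    rwa [hτ1, inv_one] at this
  have hWle : ∀ n, ‖W n‖ ≤ (T n 1)⁻¹ * ‖U‖ := fun n => by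
    rw [hW, norm_smul, Real.norm_of_nonneg (inv_pos.2 (hT1 n)).le]
    exact mul_le_mul_of_nonneg_left (norm_compJet_le hp _ _) (inv_pos.2 (hT1 n)).le
  have hbd : Tendsto (fun n => (T n 1)⁻¹ * ‖U‖) atTop (𝓝 ‖U‖) := by
    simpa using hinv.mul_const ‖U‖
  have hWU : Tendsto W atTop (𝓝 U) := by
    rw [Metric.tendsto_nhds]
    intro η hη
    -- The competitors `W n` have norm at most ‖U‖/T n 1, which tends to the minimum; uniform
    -- convexity then forces them to converge to `U`.
    obtain ⟨δ, hδ, h⟩ := exists_forall_norm_sub_lt hp1' hp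
      (fun U hU V hV => midpoint_mem_candidates hΩ hp hU hV) (norm_nonneg U) hmin hη
    filter_upwards [(tendsto_order.1 hbd).2 (‖U‖ + δ) (by linarith)] with n hn
    rw [dist_eq_norm]
    exact h _ (hWK n) _ hU ((hWle n).trans_lt hn) (by linarith)
  obtain ⟨ns, hns, hae⟩ := exists_subseq_ae_tendsto hWU
  have hWx : ∀ᵐ x ∂volume.restrict Ω, ∀ n, W n none x = (T n 1)⁻¹ * T n (U none x) := by
    refine ae_all_iff.2 fun n => ?_
    filter_upwards [coeFn_smul_none (T n 1)⁻¹ (compJet (hT n) U), coeFn_compJet_none (hT n) U]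
      with x h1 h2
    rw [h1, h2]
  filter_upwards [hae, hWx] with x h1 h2
  simp only [h2] at h1
  have h3 := ((hinv.mul (hτ (U none x))).comp hns.tendsto_atTop)
  rw [one_mul] at h3
  exact tendsto_nhds_unique h3 h1

/-- Turns an approximation of max(t, 0) into one of t - max(t - 1, 0) = min(t, 1), the constant
T(-1) keeping the value 0 at 0. -/
theorem SmoothContraction.reflect {T T' : ℝ → ℝ} (hT : SmoothContraction T T') :
    SmoothContraction (fun t => t - (T (t - 1) - T (-1))) (fun t => 1 - T' (t - 1)) where
  hasDerivAt t := by
    have h := (hT.hasDerivAt (t - 1)).comp t ((hasDerivAt_id t).sub_const 1)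
    rw [mul_one] at h
    exact (hasDerivAt_id t).sub (h.sub_const _)
  continuous_deriv := continuous_const.sub
    (hT.continuous_deriv.comp (continuous_id.sub continuous_const))
  deriv_nonneg t := sub_nonneg.2 (hT.deriv_le_one _)
  deriv_le_one t := by linarith [hT.deriv_nonneg (t - 1)]
  map_zero := by simp

theorem ae_mem_Icc_of_minimal (hΩ : IsOpen Ω) (hp1' : 1 < p) (hp : p ≠ ∞)
    {U : LpJet p Ω} (hU : U ∈ candidates p Ω A) (hmin : ∀ V ∈ candidates p Ω A, ‖U‖ ≤ ‖V‖) :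
    ∀ᵐ x ∂volume.restrict Ω, 0 ≤ U none x ∧ U none x ≤ 1 := by
  -- The shift gives δ n = 1/(n+2) < 1, which makes the values at 1 of both contractions at least 1
  -- - δ n > 0.
  set δ : ℕ → ℝ := fun n => 1 / ((n + 1 : ℕ) + 1 : ℝ) with hδ
  have hδ0 : ∀ n, 0 < δ n := fun n => by positivity
  have hδ1 : ∀ n, δ n < 1 := fun n => by
    rw [hδ]
    simp only
    rw [div_lt_one (by positivity)]
    push_cast
    linarith [n.cast_nonneg (α := ℝ)]
  have hδlim : Tendsto δ atTop (𝓝 0) :=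
    (tendsto_add_atTop_iff_nat 1).2 (tendsto_one_div_add_atTop_nhds_zero_nat (𝕜 := ℝ))
  have hsoft : ∀ t, Tendsto (fun n => softPos (δ n) t) atTop (𝓝 (max t 0)) := fun t => by
    have h1 : Tendsto (fun n => max t 0 - δ n) atTop (𝓝 (max t 0)) := by
      simpa using hδlim.const_sub (max t 0)
    exact tendsto_of_tendsto_of_tendsto_of_le_of_le h1 tendsto_const_nhds
      (fun n => max_sub_le_softPos (hδ0 n) t) (fun n => softPos_le_max (hδ0 n) t)
  have h1 := ae_eq_of_tendsto_smoothContraction hΩ hp1' hp hU hmin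
    (fun n => smoothContraction_softPos (hδ0 n)) (fun n => by
      have h1 := max_sub_le_softPos (hδ0 n) 1
      have h2 := hδ1 n
      rw [max_eq_left zero_le_one] at h1
      linarith) (τ := fun t => max t 0) (by simp) hsoft
  have h2 := ae_eq_of_tendsto_smoothContraction hΩ hp1' hp hU hmin
    (fun n => (smoothContraction_softPos (hδ0 n)).reflect) (fun n => by
      have h1 := max_sub_le_softPos (hδ0 n) (-1)
      have h2 := hδ1 n
      have h3 := (smoothContraction_softPos (hδ0 n)).map_zero
      rw [max_eq_right (by norm_num)] at h1
      rw [sub_self, h3]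
      linarith) (τ := fun t => t - (max (t - 1) 0 - max (-1) 0)) (by simp)
      (fun t => ((hsoft (t - 1)).sub (hsoft (-1))).const_sub t)
  filter_upwards [h1, h2] with x h1 h2
  refine ⟨by rw [← h1]; exact le_max_right _ _, ?_⟩
  have h3 := le_max_left (U none x - 1) 0
  rw [max_eq_right (show (-1 : ℝ) ≤ 0 by norm_num)] at h2
  linarith

/-- The infimum over admissible functions is a lower bound on the larger set of candidates, so a
minimizing sequence of admissible functions is Cauchy by uniform convexity; its limit is a candidate
by closedness. -/
theorem exists_minimal_candidate (hΩ : IsOpen Ω) (hp1' : 1 < p) (hp : p ≠ ∞)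
    (hA : A ⊆ closure Ω) (hcap : capRoot p Ω A ≠ ∞) :
    ∃ U ∈ candidates p Ω A, ‖U‖ₑ = capRoot p Ω A := by
  set m := (capRoot p Ω A).toReal with hm
  have hmeq : ENNReal.ofReal m = capRoot p Ω A := ENNReal.ofReal_toReal hcap
  have hmle : ∀ V ∈ candidates p Ω A, m ≤ ‖V‖ := fun V hV => by
    have := ENNReal.toReal_mono enorm_ne_top (capRoot_le_of_mem_candidates hΩ hp hA hV)
    rwa [toReal_enorm] at this
  have hex : ∀ n : ℕ, ∃ U ∈ candidates p Ω A, ‖U‖ < m + 1 / (n + 1 : ℝ) := fun n => by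
    have hlt : capRoot p Ω A < ENNReal.ofReal (m + 1 / (n + 1 : ℝ)) := by
      rw [← hmeq]
      exact (ENNReal.ofReal_lt_ofReal_iff (by positivity)).2
        (lt_add_of_pos_right _ (by positivity))
    obtain ⟨U, hU, hUlt⟩ := exists_admissible_lt hlt
    refine ⟨U, admissible_subset_candidates hΩ hp hA hU, ?_⟩
    rw [← ofReal_norm] at hUlt
    exact (ENNReal.ofReal_lt_ofReal_iff (by positivity)).1 hUlt
  choose U hUK hUlt using hex
  have hm0 : 0 ≤ m := ENNReal.toReal_nonneg
  have hlim1 := tendsto_one_div_add_atTop_nhds_zero_nat (𝕜 := ℝ)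
  have hcauchy : CauchySeq U := by
    rw [Metric.cauchySeq_iff]
    intro η hη
    obtain ⟨δ, hδ, h⟩ := exists_forall_norm_sub_lt hp1' hp
      (fun U hU V hV => midpoint_mem_candidates hΩ hp hU hV) hm0 hmle hη
    obtain ⟨n₀, hn₀⟩ := eventually_atTop.1 ((tendsto_order.1 hlim1).2 δ hδ)
    refine ⟨n₀, fun k hk l hl => ?_⟩
    rw [dist_eq_norm]
    exact h _ (hUK k) _ (hUK l) (by linarith [hUlt k, hn₀ k hk]) (by linarith [hUlt l, hn₀ l hl])
  obtain ⟨V, hV⟩ := cauchySeq_tendsto_of_complete hcauchy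
  have hVK : V ∈ candidates p Ω A := (isClosed_candidates hΩ hp hA).mem_of_tendsto hV
    (Eventually.of_forall hUK)
  refine ⟨V, hVK, le_antisymm ?_ (capRoot_le_of_mem_candidates hΩ hp hA hVK)⟩
  rw [← hmeq, ← ofReal_norm]
  refine ENNReal.ofReal_le_ofReal ?_
  have h2 : Tendsto (fun n : ℕ => m + 1 / (n + 1 : ℝ)) atTop (𝓝 m) := by
    simpa using hlim1.const_add m
  exact le_of_tendsto_of_tendsto' hV.norm h2 fun n => (hUlt n).le

theorem mem_qeClass_self {u : Eucl N → ℝ} (hp : p ≠ ∞) (hu : IsQuasiCont p Ω u) :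
    u ∈ qeClass p Ω u := by
  refine ⟨hu, ?_⟩
  rw [qeOn_iff_capRoot hp]
  convert capRoot_empty (p := p) (Ω := Ω)
  exact eq_empty_of_forall_notMem fun x hx => hx.2 rfl

theorem qeClass_subset_of_qeOn_eq (hΩ : IsOpen Ω) (hp : p ≠ ∞) {u v : Eucl N → ℝ}
    (h : QEOn p Ω (closure Ω) (fun x => u x = v x)) : qeClass p Ω u ⊆ qeClass p Ω v :=
  fun _ hw => ⟨hw.1, (hw.2.and hΩ hp h).mono hp subset_rfl fun _ _ hx => hx.1.trans hx.2⟩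

theorem relCap_eq_iff (hp : p ≠ ∞) {U : LpJet p Ω} :
    ‖U‖ₑ ^ p.toReal = relCap p Ω A ↔ ‖U‖ₑ = capRoot p Ω A := by
  rw [relCap_eq_capRoot_rpow hp]
  exact (ENNReal.rpow_left_injective (toReal_exponent_pos hp).ne').eq_iff

theorem existsUnique_extremal (hΩ : IsOpen Ω) (hp1' : 1 < p) (hp : p ≠ ∞)
    (hA : A ⊆ closure Ω) (hcap : relCap p Ω A ≠ ∞) :
    ∃ e : Set (Eucl N → ℝ),
      IsExtremal p Ω A e ∧
      (∀ w, IsExtremal p Ω A w → w = e) ∧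
      (∀ u ∈ e, QEOn p Ω (closure Ω) (fun x => 0 ≤ u x ∧ u x ≤ 1)) ∧
      (∀ u ∈ e, QEOn p Ω A (fun x => u x = 1)) := by
  have hcap' : capRoot p Ω A ≠ ∞ := fun h => hcap (by
    rw [relCap_eq_capRoot_rpow hp, h, ENNReal.top_rpow_of_pos (toReal_exponent_pos hp)])
  obtain ⟨U, hUK, hUcap⟩ := exists_minimal_candidate hΩ hp1' hp hA hcap'
  have hmin : ∀ V ∈ candidates p Ω A, ‖U‖ ≤ ‖V‖ := fun V hV => by
    have := capRoot_le_of_mem_candidates hΩ hp hA hV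
    rwa [← hUcap, enorm_le_iff_norm_le] at this
  have hIcc := ae_mem_Icc_of_minimal hΩ hp1' hp hUK hmin
  have hUK' := hUK
  obtain ⟨hUt, u, hu, hUu, hu1⟩ := hUK'
  have hconst : ∀ c : ℝ, IsQuasiCont p Ω fun _ => c := fun c =>
    isQuasiCont_of_continuousOn hp continuousOn_const
  have hge : ∀ v ∈ qeClass p Ω u, QEOn p Ω A (fun x => 1 ≤ v x) := fun v hv =>
    (hu1.and hΩ hp (hv.2.mono hp hA fun _ _ h => h)).mono hp subset_rfl
      fun x _ hx => hx.2 ▸ hx.1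
  have h01 : ∀ v ∈ qeClass p Ω u, QEOn p Ω (closure Ω) (fun x => 0 ≤ v x ∧ v x ≤ 1) := by
    intro v hv
    have h0 := (hconst 0).qeOn_closure_le_of_ae hΩ hp hu (by
      filter_upwards [hIcc, hUu] with x h1 h2; rw [← h2]; exact h1.1)
    have h1 := hu.qeOn_closure_le_of_ae hΩ hp (hconst 1) (by
      filter_upwards [hIcc, hUu] with x h1 h2; rw [← h2]; exact h1.2)
    exact ((h0.and hΩ hp h1).and hΩ hp hv.2).mono hp subset_rfl fun x _ hx => hx.2 ▸ hx.1
  refine ⟨qeClass p Ω u, ⟨U, hUt, ⟨u, hu, hUu, rfl⟩, hge, (relCap_eq_iff hp).2 hUcap⟩, ?_, h01,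
    fun v hv => ((hge v hv).and hΩ hp ((h01 v hv).mono hp hA fun _ _ h => h)).mono hp subset_rfl
      fun x _ hx => le_antisymm hx.2.2 hx.1⟩
  rintro w ⟨V, hVt, ⟨v, hv, hVv, rfl⟩, hv1, hVcap⟩
  have hVK : V ∈ candidates p Ω A := ⟨hVt, v, hv, hVv, hv1 v (mem_qeClass_self hp hv)⟩
  have hnorm : ‖V‖ = ‖U‖ := by
    rw [relCap_eq_iff hp, ← hUcap] at hVcap
    rw [← toReal_enorm, hVcap, toReal_enorm]
  -- Two minimizers have norm below m + δ for every δ > 0, so taking η to be their distance in the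
  -- uniform convexity estimate is contradictory.
  have hVU : V = U := by
    by_contra hne
    obtain ⟨δ, hδ, h⟩ := exists_forall_norm_sub_lt hp1' hp
      (fun U hU V hV => midpoint_mem_candidates hΩ hp hU hV) (norm_nonneg U) hmin
      (norm_pos_iff.2 (sub_ne_zero.2 hne))
    exact lt_irrefl _ (h V hVK U hUK (by linarith) (by linarith))
  subst hVU
  have hvu := hv.qeOn_closure_eq_of_ae hΩ hp hu (hVv.symm.trans hUu)
  exact Subset.antisymm (qeClass_subset_of_qeOn_eq hΩ hp hvu)
    (qeClass_subset_of_qeOn_eq hΩ hp (hvu.mono hp subset_rfl fun _ _ h => h.symm))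

end RelativeCapacity
end

open RelativeCapacity in
theorem mainTheorem6 (N : ℕ) (Ω : Set (Eucl N)) (hΩ : IsOpen Ω) (hΩne : Ω.Nonempty)
    (p : ℝ≥0∞) [Fact (1 ≤ p)] (hp : 1 < p) (hp' : p < ∞)
    (A : Set (Eucl N)) (hA : A ⊆ closure Ω) (hcap : relCap p Ω A < ∞) :
    ∃ e : Set (Eucl N → ℝ),
      IsExtremal p Ω A e ∧
      (∀ w, IsExtremal p Ω A w → w = e) ∧
      (∀ u ∈ e, QEOn p Ω (closure Ω) (fun x => 0 ≤ u x ∧ u x ≤ 1)) ∧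
      (∀ u ∈ e, QEOn p Ω A (fun x => u x = 1)) := by
  exact existsUnique_extremal hΩ hp hp'.ne hA hcap.ne
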